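/- Let $\widehat{\mathfrak{sl}_2}'=\mathfrak{sl}_2\otimes\mathbb{C}[t,t^{-1}]\oplus\mathbb{C}K$ with $x_n=x\otimes t^n$, bracket $[x_n,y_m]=[x,y]_{n+m}+n\,\delta_{n,-m}\,\mathrm{tr}(xy)\,K$ and $K$ central. Let $L_{(0,1)}$ denote the irreducible highest weight module of highest weight $(0,1)$, i.e. the irreducible $\widehat{\mathfrak{sl}_2}'$-module with a cyclic vector $v$ such that $e_0v=0$, $x_nv=0$ for all $x\in\mathfrak{sl}_2$, $n>0$, and $h_0v=0$, $Kv=v$. Let $V_{\sqrt2\mathbb{Z}}=\bigoplus_{j\in\mathbb{Z}}F_{j\sqrt2}$, where $F_\mu$ is the Fock module, with highest weight vector $|\mu\rangle$ and $a_0|\mu\rangle=\mu|\mu\rangle$, over the Heisenberg algebra $[a_n,a_m]=n\,\delta_{n,-m}$. For $\mu=\pm\sqrt2$ put $$V_\mu(z)=e^{\mu q}\,z^{\mu a_0}\exp\Big(-\mu\sum_{n<0}\frac{a_n}{n}z^{-n}\Big)\exp\Big(-\mu\sum_{n>0}\frac{a_n}{n}z^{-n}\Big),$$ where $e^{\mu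 q}\colon F_\lambda\to F_{\lambda+\mu}$ commutes with all $a_n$, $n\ne0$, and sends $|\lambda\rangle$ to $|\lambda+\mu\rangle$. Define operators $e_n,f_n$ on $V_{\sqrt2\mathbb{Z}}$ by $V_{\sqrt2}(z)=\sum_n e_nz^{-n-1}$ and $V_{-\sqrt2}(z)=\sum_n f_nz^{-n-1}$, and let $W_j=\mathbb{C}[e_i\mid i\in\mathbb{Z}]\,|j\sqrt2\rangle$ $(j\in\mathbb{Z})$ be the basic subspaces. An infinite Fibonacci configuration of type $(1,1)$ is a function $a\colon\mathbb{Z}\to\{0,1\}$ such that $a_i+a_{i+1}\le1$ for all $i$, $a_i=0$ for $i\gg1$, and, for $n\gg1$, $a_{-n}=1$ if $n$ is odd and $a_{-n}=0$ if $n$ is even. Let $\tau(a)_1<\tau(a)_2<\cdots$ be the increasing enumeration of $\{-i\mid a_i=1\}$. The semi-infinite monomial $\mathbf e_a=e_{\tau(a)_1}e_{\tau(a)_2}e_{\tau(a)_3}\cdots\in V_{\sqrt2\mathbb{Z}}$ is defined through the identification $|j\sqrt2\rangle=e_{1-2j}\,e_{3-2j}\,e_{5-2j}\cdots$; that is, $\mathbf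 e_a=e_{\tau(a)_1}\cdots e_{\tau(a)_k}\,|j_k\sqrt2\rangle$ with $1-2j_k=\tau(a)_{k+1}$, for all sufficiently large $k$. **Theorem.** There is an action of $\widehat{\mathfrak{sl}_2}'$ on $V_{\sqrt2\mathbb{Z}}$ in which $e\otimes t^n$, $f\otimes t^n$, $h\otimes t^n$ and $K$ act as $e_n$, $f_n$, $\sqrt2\,a_n$ and $1$, respectively, and with this action $V_{\sqrt2\mathbb{Z}}$ is the module $L_{(0,1)}$. The union $W=\bigcup_{j\in\mathbb{Z}}W_j$ is invariant under $\widehat{\mathfrak{sl}_2}'$, and $W=V_{\sqrt2\mathbb{Z}}\simeq L_{(0,1)}$. Moreover, for every infinite Fibonacci configuration $a$ of type $(1,1)$ the vector $\mathbf e_a$ is well defined (the vectors $e_{\tau(a)_1}\cdots e_{\tau(a)_k}\,|j_k\sqrt2\rangle$ do not depend on $k$ for $k\gg1$), and the vectors $\mathbf e_a$, with $a$ running over all such configurations, form a basis of $V_{\sqrt2\mathbb{Z}}\simeq L_{(0,1)}$. -/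

import Mathlib

open Filter
open scoped TensorProduct

noncomputable section

namespace FeiginStoyanovsky

/-! ### The affine Lie algebra: the central extension of the loop algebra of `sl₂` -/

/-- The Lie algebra `sl₂` of traceless complex `2 × 2` matrices. -/
abbrev Sl2 : Type := LieAlgebra.SpecialLinear.sl (Fin 2) ℂ

/-- The standard basis vector `e` of `sl₂`. -/
def sl2E : Sl2 := ⟨!![0, 1; 0, 0], by
  simp [LieAlgebra.SpecialLinear.sl, Matrix.trace_fin_two]⟩

/-- The standard basis vector `f` of `sl₂`. -/
def sl2F : Sl2 := ⟨!![0, 0; 1, 0], by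
  simp [LieAlgebra.SpecialLinear.sl, Matrix.trace_fin_two]⟩

/-- The standard basis vector `h` of `sl₂`. -/
def sl2H : Sl2 := ⟨!![1, 0; 0, -1], by
  simp [LieAlgebra.SpecialLinear.sl, Matrix.trace_fin_two]⟩

/-- The trace form `(x, y) ↦ tr (x y)` on `sl₂`; so `(e, f) = 1` and `(h, h) = 2`. -/
def sl2Form : LinearMap.BilinForm ℂ Sl2 :=
  LinearMap.mk₂ ℂ (fun x y : Sl2 => Matrix.trace (x.1 * y.1))
    (by intro x y z; simp [add_mul])
    (by intro c x y; simp)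
    (by intro x y z; simp [mul_add])
    (by intro c x y; simp)

theorem neg_sl2Form_isSymm : (-sl2Form).IsSymm :=
  ⟨fun x y => by
    simp only [LinearMap.neg_apply, sl2Form, LinearMap.mk₂_apply]
    rw [Matrix.trace_mul_comm]⟩

theorem neg_sl2Form_lieInvariant : (-sl2Form).lieInvariant Sl2 := by
  intro x y z
  simp only [LinearMap.neg_apply, sl2Form, LinearMap.mk₂_apply,
    LieAlgebra.SpecialLinear.sl_bracket]
  rw [sub_mul, mul_sub, Matrix.trace_sub, Matrix.trace_sub, Matrix.mul_assoc y.1 x.1 z.1,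
    Matrix.mul_assoc x.1 y.1 z.1, Matrix.trace_mul_comm x.1 (y.1 * z.1),
    Matrix.mul_assoc y.1 z.1 x.1]
  ring

/-- The cocycle `(x tⁿ, y tᵐ) ↦ n δ_{n,-m} tr (x y)` on the loop algebra. Mathlib's residue pairing
attached to a form `Φ` is `(x tⁿ, y tᵐ) ↦ m δ_{n,-m} Φ(x, y)`, whence the minus sign. -/
abbrev affineCocycle :=
  LieAlgebra.LoopAlgebra.twoCocycleOfBilinear ℂ ℤ Sl2 (-sl2Form)
    neg_sl2Form_lieInvariant neg_sl2Form_isSymm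

/-- The affine Lie algebra `sl₂ ⊗ ℂ[t, t⁻¹] ⊕ ℂ K`, with
`[x tⁿ, y tᵐ] = [x, y] tⁿ⁺ᵐ + n δ_{n,-m} tr (x y) K` and `K` central. -/
abbrev AffineSl2 : Type := LieAlgebra.ofTwoCocycle affineCocycle

/-- The element `x tⁿ` of the affine Lie algebra. -/
def loopElt (x : Sl2) (n : ℤ) : AffineSl2 :=
  LieAlgebra.ofProd affineCocycle (AddMonoidAlgebra.single n 1 ⊗ₜ[ℂ] x, 0)

/-- The central element `K`. -/
def centralK : AffineSl2 :=
  LieAlgebra.ofProd affineCocycle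
    (0, (TrivialLieModule.equiv ℂ (LieAlgebra.loopAlgebra ℂ ℤ Sl2) ℂ).symm 1)

/-- `M` is an irreducible highest weight module of highest weight `(l, k)`: it is irreducible and
has a cyclic vector `v` annihilated by `𝔫₊ = ⟨e₀⟩ + ∑_{n > 0} tⁿ sl₂` with `h₀ v = l v` and
`K v = k v`. For `(l, k) = (0, 1)` this is the standard module `L_{(0,1)}`. -/
def IsHighestWeightModule (l k : ℂ) (M : Type*) [AddCommGroup M] [Module ℂ M]
    [LieRingModule AffineSl2 M] [LieModule ℂ AffineSl2 M] : Prop :=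
  LieModule.IsIrreducible ℂ AffineSl2 M ∧
    ∃ v : M, LieSubmodule.lieSpan ℂ AffineSl2 {v} = ⊤ ∧
      ⁅loopElt sl2E 0, v⁆ = 0 ∧
      (∀ n : ℤ, 0 < n → ∀ x : Sl2, ⁅loopElt x n, v⁆ = 0) ∧
      ⁅loopElt sl2H 0, v⁆ = l • v ∧ ⁅centralK, v⁆ = k • v

/-! ### Fock spaces and the lattice vertex algebra -/

/-- The space of a Fock module: polynomials in `x₀, x₁, …`, where `xᵢ` stands for `a_{-(i+1)}`. -/
abbrev Fock : Type := MvPolynomial ℕ ℂ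

/-- The nonzero modes `aₙ` of the Heisenberg algebra, `[aₙ, aₘ] = n δ_{n,-m}`, on a Fock space:
`a_{-(i+1)}` is multiplication by `xᵢ` and `a_{i+1}` is `(i+1) ∂/∂xᵢ`. (Value `0` at `n = 0`.) -/
def oscillator : ℤ → Module.End ℂ Fock
  | .ofNat 0 => 0
  | .ofNat (i + 1) => ((i : ℂ) + 1) • (MvPolynomial.pderiv i).toLinearMap
  | .negSucc i => LinearMap.mulLeft ℂ (MvPolynomial.X i)

/-- The space of `V_{√2 ℤ} = ⨁_{j ∈ ℤ} F_{j√2}`. -/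
abbrev LatticeV : Type := ℤ →₀ Fock

/-- The highest weight vector `|j√2⟩` of `F_{j√2}`. -/
def vac (j : ℤ) : LatticeV := Finsupp.single j 1

/-- The number `√2`. -/
def rootTwo : ℂ := ((Real.sqrt 2 : ℝ) : ℂ)

/-- The Heisenberg mode `aₙ` on `V_{√2 ℤ}`; `a₀` acts on `F_{j√2}` as the scalar `j√2`. -/
def heisMode (n : ℤ) : Module.End ℂ LatticeV :=
  Finsupp.lsum ℂ fun j : ℤ => Finsupp.lsingle j ∘ₗ
    (if n = 0 then ((j : ℂ) * rootTwo) • LinearMap.id else oscillator n)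

/-- The coefficient of `zᵏ` in `exp b(z) = ∑ₘ b(z)ᵐ / m!`, for a power series `b` without constant
term (so that only the `m ≤ k` contribute). -/
def expCoeff {A : Type*} [Ring A] [Algebra ℂ A] (b : PowerSeries A) (k : ℕ) : A :=
  ∑ m ∈ Finset.range (k + 1), ((m.factorial : ℂ)⁻¹) • PowerSeries.coeff k (b ^ m)

/-- The power series `-μ ∑_{n < 0} (aₙ / n) z⁻ⁿ` in `z`. -/
def creationSeries (μ : ℂ) : PowerSeries (Module.End ℂ Fock) :=
  PowerSeries.mk fun m => if m = 0 then 0 else (-μ / (-(m : ℂ))) • oscillator (-(m : ℤ))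

/-- The power series `-μ ∑_{n > 0} (aₙ / n) z⁻ⁿ` in `z⁻¹`. -/
def annihilationSeries (μ : ℂ) : PowerSeries (Module.End ℂ Fock) :=
  PowerSeries.mk fun m => if m = 0 then 0 else (-μ / (m : ℂ)) • oscillator (m : ℤ)

/-- The weight of a monomial, `xᵢ` having weight `i + 1`. -/
abbrev monoWeight (s : ℕ →₀ ℕ) : ℕ := s.sum fun i c => c * (i + 1)

/-- The polynomials all of whose monomials have weight `< d`. -/
def weightLT (d : ℕ) : Submodule ℂ Fock :=
  MvPolynomial.restrictSupport ℂ {s | monoWeight s < d}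

theorem exists_mem_weightLT (f : Fock) : ∃ d, f ∈ weightLT d := by
  refine ⟨f.support.sup monoWeight + 1, ?_⟩
  rw [weightLT, MvPolynomial.mem_restrictSupport_iff]
  intro s hs
  exact Nat.lt_succ_of_le (Finset.le_sup (f := monoWeight) hs)

theorem oscillator_mem_weightLT (n d : ℕ) (f : Fock) (hf : f ∈ weightLT d) :
    oscillator (n : ℤ) f ∈ weightLT (d - n) := by
  cases n with
  | zero =>
    have h : oscillator ((0 : ℕ) : ℤ) = 0 := rfl
    rw [h, LinearMap.zero_apply]
    exact Submodule.zero_mem _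
  | succ i =>
    have h : oscillator ((i + 1 : ℕ) : ℤ) =
      ((i : ℂ) + 1) • (MvPolynomial.pderiv i).toLinearMap := rfl
    rw [h, LinearMap.smul_apply]
    refine Submodule.smul_mem _ _ ?_
    rw [weightLT, MvPolynomial.restrictSupport_eq_span] at hf
    induction hf using Submodule.span_induction with
    | zero => simp
    | add x y _ _ hx hy => rw [map_add]; exact Submodule.add_mem _ hx hy
    | smul c x _ hx => rw [map_smul]; exact Submodule.smul_mem _ _ hx
    | mem x hx =>
      obtain ⟨s, hs, rfl⟩ := hx
      change MvPolynomial.pderiv i (MvPolynomial.monomial s (1 : ℂ)) ∈ _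
      rw [MvPolynomial.pderiv_monomial]
      by_cases h0 : s i = 0
      · simp [h0]
      · rw [weightLT, MvPolynomial.monomial_mem_restrictSupport]
        left
        have h1 : s = (s - Finsupp.single i 1) + Finsupp.single i 1 := by
          refine (tsub_add_cancel_of_le ?_).symm
          simpa using Nat.one_le_iff_ne_zero.2 h0
        have h2 : monoWeight s = monoWeight (s - Finsupp.single i 1) + (i + 1) := by
          conv_lhs => rw [h1]
          rw [monoWeight, Finsupp.sum_add_index' (by simp) (by intros; ring)]
          simp
        have hs' : monoWeight s < d := hs
        change monoWeight (s - Finsupp.single i 1) < d - (i + 1)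
        omega

theorem coeff_pow_mem_weightLT (μ : ℂ) (m : ℕ) : ∀ (l d : ℕ) (f : Fock), f ∈ weightLT d →
    PowerSeries.coeff l (annihilationSeries μ ^ m) f ∈ weightLT (d - l) := by
  induction m with
  | zero =>
    intro l d f hf
    rw [pow_zero, PowerSeries.coeff_one]
    split_ifs with h
    · subst h; simpa using hf
    · simp
  | succ m ih =>
    intro l d f hf
    rw [pow_succ', PowerSeries.coeff_mul, LinearMap.sum_apply]
    refine Submodule.sum_mem _ fun p hp => ?_
    replace hp : p.1 + p.2 = l := by simpa using hp
    rw [Module.End.mul_apply, annihilationSeries, PowerSeries.coeff_mk]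
    have h2 := ih p.2 d f hf
    split_ifs with h
    · simp
    · rw [LinearMap.smul_apply]
      refine Submodule.smul_mem _ _ ?_
      have := oscillator_mem_weightLT p.1 _ _ h2
      rwa [Nat.sub_sub, add_comm, hp] at this

theorem finite_support_annihilation (μ : ℂ) (f : Fock) :
    {l : ℕ | expCoeff (annihilationSeries μ) l f ≠ 0}.Finite := by
  obtain ⟨d, hd⟩ := exists_mem_weightLT f
  refine (Set.finite_lt_nat d).subset fun l hl => ?_
  by_contra hld
  apply hl
  rw [expCoeff, LinearMap.sum_apply]
  refine Finset.sum_eq_zero fun m _ => ?_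
  have h := coeff_pow_mem_weightLT μ m l d f hd
  rw [Nat.sub_eq_zero_of_le (not_lt.1 hld), weightLT, MvPolynomial.mem_restrictSupport_iff] at h
  have h0 : PowerSeries.coeff l (annihilationSeries μ ^ m) f = 0 := by
    rw [← MvPolynomial.support_eq_empty]
    exact Finset.eq_empty_of_forall_notMem fun s hs => absurd (h hs) (by simp)
  rw [LinearMap.smul_apply, h0, smul_zero]

/-- The coefficient of `zᵈ` in
`exp(-μ ∑_{n<0} (aₙ/n) z⁻ⁿ) exp(-μ ∑_{n>0} (aₙ/n) z⁻ⁿ)`, an operator on a Fock space; the sum over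
the exponent `-l` of the second factor is finite on each vector. -/
def fockVertexCoeff (μ : ℂ) (d : ℤ) : Module.End ℂ Fock where
  toFun f := ∑ᶠ l : ℕ,
    if 0 ≤ d + l then
      expCoeff (creationSeries μ) (d + l).toNat (expCoeff (annihilationSeries μ) l f)
    else 0
  map_add' f g := by
    rw [← finsum_add_distrib]
    · refine finsum_congr fun l => ?_
      split_ifs <;> simp
    · refine (finite_support_annihilation μ f).subset fun l hl h0 => hl ?_
      simp [h0]
    · refine (finite_support_annihilation μ g).subset fun l hl h0 => hl ?_
      simp [h0]
  map_smul' c f := by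
    rw [RingHom.id_apply, smul_finsum]
    refine finsum_congr fun l => ?_
    split_ifs <;> simp

/-- The coefficient of `zᵖ` in the vertex operator, for `μ = ε√2`,
`V_μ(z) = e^{μ q} z^{μ a₀} exp(-μ ∑_{n<0} (aₙ/n) z⁻ⁿ) exp(-μ ∑_{n>0} (aₙ/n) z⁻ⁿ)`.
On `F_{j√2}` the factor `z^{μ a₀}` is `z^{2εj}`, and `e^{μ q}` maps `F_{j√2}` identically onto
`F_{(j+ε)√2}`. -/
def vertexCoeff (ε p : ℤ) : Module.End ℂ LatticeV :=
  Finsupp.lsum ℂ fun j : ℤ => Finsupp.lsingle (j + ε) ∘ₗ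
    fockVertexCoeff ((ε : ℂ) * rootTwo) (p - 2 * ε * j)

/-- The modes of `e(z) = V_{√2}(z) = ∑ₙ eₙ z^{-n-1}`. -/
def eMode (n : ℤ) : Module.End ℂ LatticeV := vertexCoeff 1 (-n - 1)

/-- The modes of `f(z) = V_{-√2}(z) = ∑ₙ fₙ z^{-n-1}`. -/
def fMode (n : ℤ) : Module.End ℂ LatticeV := vertexCoeff (-1) (-n - 1)

/-- The basic subspace `W_j = ℂ[eᵢ | i ∈ ℤ] |j√2⟩`. -/
def basicSubspace (j : ℤ) : Submodule ℂ LatticeV :=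
  (Subalgebra.toSubmodule (Algebra.adjoin ℂ (Set.range eMode))).map
    (LinearMap.applyₗ (vac j) : Module.End ℂ LatticeV →ₗ[ℂ] LatticeV)

/-! ### Fibonacci configurations and semi-infinite monomials -/

/-- Infinite Fibonacci configurations of type `(θ, l)`. -/
structure FibConfig (θ l : ℤ) where
  /-- The underlying sequence of zeros and ones. -/
  a : ℤ → ℕ
  zero_or_one : ∀ i, a i = 0 ∨ a i = 1
  window : ∀ i, ∑ k ∈ Finset.Icc i (i + l), a k ≤ 1
  eventually_zero : ∃ B : ℤ, ∀ i, B < i → a i = 0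
  eventually_periodic : ∃ B : ℤ, ∀ n, B < n → a (-n) = if -n ≡ θ [ZMOD l + 1] then 1 else 0

/-- The positions of the ones of a configuration, in decreasing order. -/
def onePos {θ l : ℤ} (c : FibConfig θ l) : ℕ → ℤ
  | 0 => sSup {i | c.a i ≠ 0}
  | k + 1 => sSup {i | c.a i ≠ 0 ∧ i < onePos c k}

/-- The increasing sequence `τ(a)`, indexed from `0`, of the negatives of the positions of ones. -/
def tau {θ l : ℤ} (c : FibConfig θ l) (k : ℕ) : ℤ := -onePos c k

/-- The truncation after `k` factors of the semi-infinite monomial `e_{τ(a)₁} e_{τ(a)₂} …`, the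
remaining factors `e_{1-2j} e_{3-2j} e_{5-2j} …`, with `1 - 2j = τ(a)_{k+1}`, being replaced by the
vector `|j√2⟩`. For a configuration of type `(1, 1)` the tail has this form for all large `k`. -/
def truncatedMonomial (c : FibConfig 1 1) (k : ℕ) : LatticeV :=
  ((List.range k).map fun i => eMode (tau c i)).prod (vac ((1 - tau c k) / 2))

end FeiginStoyanovsky

end

noncomputable section

namespace FeiginStoyanovsky

/-! ### Coefficients of exponentials -/

/-! Everything is reduced to the polynomial ring `Fock`. Let h_n be the coefficient of zⁿ in exp(μ ∑
x_{m-1} zᵐ/m) (`vertexPoly μ n`). Positive oscillators only shift the index of h_n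
(`oscillator_vertexPoly`), and a polynomial is determined by its images under them together with its
constant term (`eq_of_oscillator_eq`); the main polynomial identities are checked this way. In
particular the annihilation part for μ multiplies the creation series for ν by (1 - z)^(μν)
(`annihilCoeff_vertexPoly`).

The affine relations are first verified on the vacua |j√2⟩. For two e's or two f's, μν = 2 and the
factor is a square, symmetric in the two fields. For e and f, μν = -2 and the two orders are
opposite expansions of a double pole; their difference is a sum over all integers
(`fockVertexCoeff_vertexPoly_sub`), evaluated because the two creation series are inverse to each
other. Bracketing with Heisenberg modes reproduces the relations, which therefore pass from the
vacua to all vectors (`eq_zero_of_lie_heisMode`).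

Irreducibility: the eigenvalues of a_0 separate the summands, positive oscillators lead down to a
vacuum, e and f connect the vacua, and creation operators rebuild each summand
(`eq_top_of_modes_mem`).

Basis: since consecutive ones are at distance at least 2, a configuration is the same as a charge j
and a partition λ, with τ_k = 2k + 1 - 2j - λ_k for k ≥ 0 (`exists_fibConfig_equiv`). The
semi-infinite monomial is then U_{λ_0} U_{λ_1} ⋯ 1 in F_{j√2}, where U_d is the degree d vertex
coefficient (`prod_eMode_vac`). It equals the product of the h_{λ_k} plus colexicographically higher
monomials in the h's of the same weight (`fockMonomial_sub_mem`). The h's are polynomial generators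
(`vertexHom_bijective`) and each weight has finitely many monomials, so this triangular system gives
a basis. Each basis vector lies in some W_j and the W_j are nested, so their union is the whole
space. -/

theorem coeff_pow_eq_zero_of_lt {A : Type*} [Ring A] {b : PowerSeries A}
    (hb : PowerSeries.coeff 0 b = 0) (m : ℕ) :
    ∀ k < m, PowerSeries.coeff k (b ^ m) = 0 := by
  induction m with
  | zero => intro k hk; omega
  | succ m ih =>
    intro k hk
    rw [pow_succ', PowerSeries.coeff_mul]
    refine Finset.sum_eq_zero fun p hp => ?_
    replace hp : p.1 + p.2 = k := by simpa using hp
    rcases Nat.eq_zero_or_pos p.1 with h | h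
    · rw [h, hb, zero_mul]
    · rw [ih p.2 (by omega), mul_zero]

section ExpCoeff

variable {A B : Type*} [Ring A] [Algebra ℂ A] [Ring B] [Algebra ℂ B]

theorem map_expCoeff (φ : A →ₐ[ℂ] B) (b : PowerSeries A) (k : ℕ) :
    φ (expCoeff b k) = expCoeff (PowerSeries.map φ.toRingHom b) k := by
  simp only [expCoeff, map_sum, map_smul]
  refine Finset.sum_congr rfl fun m _ => ?_
  rw [← map_pow, PowerSeries.coeff_map]
  rfl

/-- As bᵐ starts in degree m, the truncation of the exponential may be lengthened freely; this lets
coefficients of different degrees be compared. -/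
theorem expCoeff_eq_sum_range {b : PowerSeries A} (hb : PowerSeries.coeff 0 b = 0) {k N : ℕ}
    (h : k < N) :
    expCoeff b k = ∑ m ∈ Finset.range N, ((m.factorial : ℂ)⁻¹) • PowerSeries.coeff k (b ^ m) := by
  refine Finset.sum_subset (Finset.range_subset_range.2 h) fun m _ hm => ?_
  rw [coeff_pow_eq_zero_of_lt hb m k (by simpa using hm), smul_zero]

theorem expCoeff_zero (b : PowerSeries A) : expCoeff b 0 = 1 := by
  simp [expCoeff]

theorem expCoeff_zero_left {k : ℕ} (hk : k ≠ 0) : expCoeff (0 : PowerSeries A) k = 0 := by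
  refine Finset.sum_eq_zero fun m _ => ?_
  rcases Nat.eq_zero_or_pos m with rfl | h
  · simp [PowerSeries.coeff_one, hk]
  · simp [h.ne']

theorem pow_mul_C_of_commutator {b : PowerSeries A} {L : A} {c : ℂ} {s : ℕ}
    (h : b * PowerSeries.C L = PowerSeries.C L * b + c • PowerSeries.X ^ s) (m : ℕ) :
    b ^ (m + 1) * PowerSeries.C L = PowerSeries.C L * b ^ (m + 1) +
      ((m + 1 : ℂ) * c) • (PowerSeries.X ^ s * b ^ m) := by
  induction m with
  | zero => simpa using h
  | succ m ih =>
    have hX : PowerSeries.X ^ s * b = b * PowerSeries.X ^ s := (PowerSeries.commute_X_pow b s).symm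
    rw [pow_succ' b (m + 1), mul_assoc, ih, mul_add, ← mul_assoc, h, add_mul, mul_assoc, add_assoc,
      smul_mul_assoc, mul_smul_comm, ← mul_assoc b, ← hX, mul_assoc, ← pow_succ' b m,
      ← add_smul]
    congr 2
    push_cast
    ring

/-- Because [b, L] = c zˢ commutes with b, bracketing bᵐ⁺¹/(m+1)! with L gives c zˢ bᵐ/m!, so [exp
b, L] = c zˢ exp b. Used for the creation exponential against derivatives and for the annihilation
exponential against variables. -/
theorem expCoeff_mul_of_commutator {b : PowerSeries A} (hb : PowerSeries.coeff 0 b = 0) {L : A}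
    {c : ℂ} {s : ℕ} (hs : 0 < s)
    (h : b * PowerSeries.C L = PowerSeries.C L * b + c • PowerSeries.X ^ s) (k : ℕ) :
    expCoeff b k * L = L * expCoeff b k + if s ≤ k then c • expCoeff b (k - s) else 0 := by
  have key : ∀ m : ℕ, PowerSeries.coeff k (b ^ (m + 1)) * L = L * PowerSeries.coeff k (b ^ (m + 1))
      + ((m + 1 : ℂ) * c) • if s ≤ k then PowerSeries.coeff (k - s) (b ^ m) else 0 := by
    intro m
    have := congrArg (PowerSeries.coeff k) (pow_mul_C_of_commutator h m)
    rwa [PowerSeries.coeff_mul_C, map_add, PowerSeries.coeff_C_mul, PowerSeries.coeff_smul,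
      PowerSeries.coeff_X_pow_mul'] at this
  rw [expCoeff, Finset.sum_range_succ', add_mul, mul_add, Finset.sum_mul, Finset.mul_sum]
  simp only [smul_mul_assoc, mul_smul_comm, key, smul_add, Finset.sum_add_distrib]
  have h0 : PowerSeries.coeff k (b ^ 0) * L = L * PowerSeries.coeff k (b ^ 0) := by
    rw [pow_zero, PowerSeries.coeff_one]; split_ifs <;> simp
  rw [h0, add_right_comm]
  congr 1
  split_ifs with hk
  · rw [expCoeff_eq_sum_range hb (show k - s < k by omega), Finset.smul_sum]
    refine Finset.sum_congr rfl fun m _ => ?_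
    rw [smul_smul, smul_smul, Nat.factorial_succ]
    congr 1
    have h1 : (m.factorial : ℂ) ≠ 0 := by exact_mod_cast m.factorial_ne_zero
    have h2 : (m : ℂ) + 1 ≠ 0 := by exact_mod_cast m.succ_ne_zero
    push_cast
    field_simp
  · simp

theorem expCoeff_commute {b : PowerSeries A} {L : A}
    (h : ∀ k, Commute (PowerSeries.coeff k b) L) (k : ℕ) : Commute (expCoeff b k) L := by
  have hC : Commute b (PowerSeries.C L) := by
    refine PowerSeries.ext fun n => ?_
    rw [PowerSeries.coeff_mul_C, PowerSeries.coeff_C_mul]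
    exact h n
  refine Commute.sum_left _ _ _ fun m _ => Commute.smul_left ?_ _
  have := congrArg (PowerSeries.coeff k) (hC.pow_left m).eq
  rwa [PowerSeries.coeff_mul_C, PowerSeries.coeff_C_mul] at this

end ExpCoeff

/-! ### The creation part of a vertex operator -/

theorem oscillator_natCast_succ (i : ℕ) : oscillator ((i + 1 : ℕ) : ℤ) =
    ((i : ℂ) + 1) • (MvPolynomial.pderiv i).toLinearMap := rfl

theorem oscillator_neg_succ (i : ℕ) : oscillator (-((i + 1 : ℕ) : ℤ)) =
    LinearMap.mulLeft ℂ (MvPolynomial.X i) := rfl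

theorem oscillator_natCast_succ_mul (i : ℕ) (f g : Fock) :
    oscillator ((i + 1 : ℕ) : ℤ) (f * g) =
      oscillator ((i + 1 : ℕ) : ℤ) f * g + f * oscillator ((i + 1 : ℕ) : ℤ) g := by
  simp only [oscillator_natCast_succ, LinearMap.smul_apply]
  change _ • MvPolynomial.pderiv i (f * g) = (_ • MvPolynomial.pderiv i f) * g +
    f * (_ • MvPolynomial.pderiv i g)
  rw [Derivation.leibniz, smul_add, smul_mul_assoc, mul_smul_comm, smul_eq_mul, smul_eq_mul,
    mul_comm g, add_comm]

theorem oscillator_natCast_succ_X (i j : ℕ) :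
    oscillator ((i + 1 : ℕ) : ℤ) (MvPolynomial.X j) =
      if i = j then MvPolynomial.C ((i : ℂ) + 1) else 0 := by
  rw [oscillator_natCast_succ, LinearMap.smul_apply]
  change _ • MvPolynomial.pderiv i (MvPolynomial.X j : Fock) = _
  rw [MvPolynomial.pderiv_X, Pi.single_apply]
  rcases eq_or_ne i j with rfl | h
  · simp [MvPolynomial.smul_eq_C_mul]
  · simp [h, h.symm]

theorem oscillator_natCast_succ_one (i : ℕ) : oscillator ((i + 1 : ℕ) : ℤ) (1 : Fock) = 0 := by
  rw [oscillator_natCast_succ, LinearMap.smul_apply]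
  change _ • MvPolynomial.pderiv i (1 : Fock) = _
  simp

/-- The power series `μ ∑_{n > 0} x_{n-1} zⁿ / n` over the polynomial ring. -/
def creationPoly (μ : ℂ) : PowerSeries Fock :=
  PowerSeries.mk fun m => if m = 0 then 0 else (μ / (m : ℂ)) • MvPolynomial.X (m - 1)

/-- The coefficient of `zⁿ` in `exp (μ ∑_{m > 0} x_{m-1} zᵐ / m)`, for any integer `n`. -/
def vertexPoly (μ : ℂ) (n : ℤ) : Fock :=
  if 0 ≤ n then expCoeff (creationPoly μ) n.toNat else 0

theorem vertexPoly_natCast (μ : ℂ) (m : ℕ) :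
    vertexPoly μ (m : ℤ) = expCoeff (creationPoly μ) m := by
  simp [vertexPoly]

theorem vertexPoly_of_neg (μ : ℂ) {n : ℤ} (hn : n < 0) : vertexPoly μ n = 0 :=
  if_neg (not_le.2 hn)

theorem expCoeff_creationSeries (μ : ℂ) (m : ℕ) :
    expCoeff (creationSeries μ) m = LinearMap.mulLeft ℂ (vertexPoly μ (m : ℤ)) := by
  have h := map_expCoeff (Algebra.lmul ℂ Fock) (creationPoly μ) m
  change LinearMap.mulLeft ℂ (expCoeff (creationPoly μ) m) = _ at h
  rw [vertexPoly_natCast, h]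
  congr 1
  ext1 k
  rw [PowerSeries.coeff_map, creationSeries, creationPoly, PowerSeries.coeff_mk,
    PowerSeries.coeff_mk]
  cases k with
  | zero => simp
  | succ i =>
    rw [if_neg i.succ_ne_zero, if_neg i.succ_ne_zero, oscillator_neg_succ, neg_div_neg_eq]
    refine LinearMap.ext fun f => ?_
    change _ = (Algebra.lmul ℂ Fock) _ f
    rw [map_smul]
    rfl

theorem vertexPoly_zero (μ : ℂ) : vertexPoly μ 0 = 1 := expCoeff_zero _

theorem constantCoeff_vertexPoly (μ : ℂ) {n : ℤ} (hn : n ≠ 0) :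
    MvPolynomial.constantCoeff (vertexPoly μ n) = 0 := by
  rcases lt_or_ge n 0 with h | h
  · rw [vertexPoly_of_neg μ h, map_zero]
  lift n to ℕ using h
  rw [vertexPoly_natCast]
  have h := map_expCoeff (MvPolynomial.aeval (fun _ => (0 : ℂ)) : Fock →ₐ[ℂ] ℂ) (creationPoly μ) n
  have h0 : PowerSeries.map (MvPolynomial.aeval (fun _ => (0 : ℂ)) : Fock →ₐ[ℂ] ℂ).toRingHom
      (creationPoly μ) = 0 := by
    ext1 k
    rw [PowerSeries.coeff_map, creationPoly, PowerSeries.coeff_mk]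
    split_ifs with hk
    · simp
    · change (MvPolynomial.aeval (fun _ => (0 : ℂ)) : Fock →ₐ[ℂ] ℂ) _ = 0
      simp
  rw [h0, expCoeff_zero_left (by simpa using hn)] at h
  rw [← h, MvPolynomial.aeval_zero']
  simp

/-- Positive oscillators kill 1, and moving one past the creation exponential costs μ zⁱ⁺¹: the
generating series of the `vertexPoly` is a joint eigenvector. -/
theorem oscillator_vertexPoly (μ : ℂ) (i : ℕ) (n : ℤ) :
    oscillator ((i + 1 : ℕ) : ℤ) (vertexPoly μ n) = μ • vertexPoly μ (n - (i + 1)) := by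
  rcases lt_or_ge n 0 with hn | hn
  · rw [vertexPoly_of_neg μ hn, vertexPoly_of_neg μ (by omega), map_zero, smul_zero]
  lift n to ℕ using hn
  have hb : PowerSeries.coeff 0 (creationSeries μ) = 0 := by
    rw [creationSeries, PowerSeries.coeff_mk, if_pos rfl]
  have h : creationSeries μ * PowerSeries.C (oscillator ((i + 1 : ℕ) : ℤ)) =
      PowerSeries.C (oscillator ((i + 1 : ℕ) : ℤ)) * creationSeries μ +
        (-μ) • PowerSeries.X ^ (i + 1) := by
    ext1 k
    rw [map_add, PowerSeries.coeff_mul_C, PowerSeries.coeff_C_mul, PowerSeries.coeff_smul,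
      PowerSeries.coeff_X_pow, creationSeries, PowerSeries.coeff_mk]
    cases k with
    | zero => simp
    | succ j =>
      rw [if_neg j.succ_ne_zero, oscillator_neg_succ]
      refine LinearMap.ext fun f => ?_
      simp only [Module.End.mul_apply, LinearMap.add_apply, LinearMap.smul_apply,
        LinearMap.mulLeft_apply, map_smul, neg_div_neg_eq, oscillator_natCast_succ_mul,
        oscillator_natCast_succ_X, smul_add, add_left_inj, eq_comm (a := j)]
      rcases eq_or_ne i j with rfl | hij
      · have h2 : (i : ℂ) + 1 ≠ 0 := by exact_mod_cast i.succ_ne_zero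
        simp only [if_true, Module.End.one_apply, ← MvPolynomial.smul_eq_C_mul, smul_smul]
        push_cast
        rw [div_mul_cancel₀ _ h2, neg_smul]
        abel
      · simp [hij]
  have key := LinearMap.congr_fun (expCoeff_mul_of_commutator hb i.succ_pos h n) 1
  simp only [expCoeff_creationSeries] at key
  rw [Module.End.mul_apply, oscillator_natCast_succ_one, map_zero, LinearMap.add_apply,
    Module.End.mul_apply, LinearMap.mulLeft_apply, mul_one] at key
  rw [eq_neg_of_add_eq_zero_left key.symm]
  split_ifs with hi
  · have hc : ((n - (i + 1) : ℕ) : ℤ) = (n : ℤ) - (i + 1) := by omega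
    simp [hc]
  · rw [vertexPoly_of_neg μ (by omega)]
    simp

theorem eq_zero_of_oscillator_eq_zero {f : Fock}
    (h : ∀ i : ℕ, oscillator ((i + 1 : ℕ) : ℤ) f = 0) (h0 : MvPolynomial.constantCoeff f = 0) :
    f = 0 := by
  ext s
  rw [MvPolynomial.coeff_zero]
  rcases eq_or_ne s 0 with rfl | hs
  · exact h0
  · obtain ⟨i, hi⟩ := Finsupp.ne_iff.1 hs
    have h1 := h i
    rw [oscillator_natCast_succ, LinearMap.smul_apply] at h1
    have hi2 : (i : ℂ) + 1 ≠ 0 := by exact_mod_cast i.succ_ne_zero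
    have h2 : MvPolynomial.pderiv i f = 0 := (smul_eq_zero.1 h1).resolve_left hi2
    have h3 := congrArg (MvPolynomial.coeff (s - Finsupp.single i 1)) h2
    rw [MvPolynomial.coeff_pderiv, MvPolynomial.coeff_zero] at h3
    rw [tsub_add_cancel_of_le (by simpa using Nat.one_le_iff_ne_zero.2 hi)] at h3
    refine (mul_eq_zero.1 h3).resolve_right ?_
    exact Nat.cast_add_one_ne_zero _

/-- In characteristic 0 the partial derivatives determine a polynomial up to its constant term. -/
theorem eq_of_oscillator_eq {f g : Fock}
    (h : ∀ i : ℕ, oscillator ((i + 1 : ℕ) : ℤ) f = oscillator ((i + 1 : ℕ) : ℤ) g)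
    (h0 : MvPolynomial.constantCoeff f = MvPolynomial.constantCoeff g) : f = g := by
  rw [← sub_eq_zero]
  refine eq_zero_of_oscillator_eq_zero (fun i => ?_) ?_
  · rw [map_sub, h, sub_self]
  · rw [map_sub, h0, sub_self]

/-! ### The annihilation part of a vertex operator -/

theorem weightLT_zero : weightLT 0 = ⊥ := by
  refine (Submodule.eq_bot_iff _).2 fun f hf => ?_
  rw [weightLT, MvPolynomial.mem_restrictSupport_iff] at hf
  rw [← MvPolynomial.support_eq_empty]
  exact Finset.eq_empty_of_forall_notMem fun s hs => absurd (hf hs) (by simp)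

theorem expCoeff_annihilationSeries_eq_zero (μ : ℂ) {d l : ℕ} {f : Fock} (hf : f ∈ weightLT d)
    (h : d ≤ l) : expCoeff (annihilationSeries μ) l f = 0 := by
  rw [expCoeff, LinearMap.sum_apply]
  refine Finset.sum_eq_zero fun m _ => ?_
  have h1 := coeff_pow_mem_weightLT μ m l d f hf
  rw [Nat.sub_eq_zero_of_le h, weightLT_zero, Submodule.mem_bot] at h1
  rw [LinearMap.smul_apply, h1, smul_zero]

/-- The coefficient of `z⁻ˡ` in `exp(-μ ∑_{n>0} (aₙ/n) z⁻ⁿ)`, for any integer `l`. -/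
def annihilCoeff (μ : ℂ) (l : ℤ) : Module.End ℂ Fock :=
  if 0 ≤ l then expCoeff (annihilationSeries μ) l.toNat else 0

theorem annihilCoeff_natCast (μ : ℂ) (l : ℕ) :
    annihilCoeff μ (l : ℤ) = expCoeff (annihilationSeries μ) l := by
  simp [annihilCoeff]

theorem annihilCoeff_of_neg (μ : ℂ) {l : ℤ} (hl : l < 0) : annihilCoeff μ l = 0 :=
  if_neg (not_le.2 hl)

theorem annihilCoeff_zero (μ : ℂ) : annihilCoeff μ 0 = 1 := expCoeff_zero _

theorem annihilCoeff_one (μ : ℂ) {l : ℤ} (hl : l ≠ 0) : annihilCoeff μ l 1 = 0 := by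
  rcases lt_or_ge l 0 with h | h
  · rw [annihilCoeff_of_neg μ h, LinearMap.zero_apply]
  lift l to ℕ using h
  rw [annihilCoeff_natCast]
  refine expCoeff_annihilationSeries_eq_zero μ (d := 1) ?_ (by omega)
  rw [← MvPolynomial.C_1, ← MvPolynomial.monomial_zero', weightLT,
    MvPolynomial.monomial_mem_restrictSupport]
  simp [monoWeight]

/-- The annihilation part is the exponential of -μ ∑ z^{-(i+1)} ∂/∂xᵢ, whose commutator with xᵢ is
the scalar -μ z^{-(i+1)}. -/
theorem annihilCoeff_X_mul (μ : ℂ) (i : ℕ) (l : ℤ) (f : Fock) :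
    annihilCoeff μ l (MvPolynomial.X i * f) =
      MvPolynomial.X i * annihilCoeff μ l f - μ • annihilCoeff μ (l - (i + 1)) f := by
  rcases lt_or_ge l 0 with hl | hl
  · simp [annihilCoeff_of_neg μ hl, annihilCoeff_of_neg μ (show l - (i + 1) < 0 by omega)]
  lift l to ℕ using hl
  have hb : PowerSeries.coeff 0 (annihilationSeries μ) = 0 := by
    rw [annihilationSeries, PowerSeries.coeff_mk, if_pos rfl]
  have h : annihilationSeries μ * PowerSeries.C (LinearMap.mulLeft ℂ (MvPolynomial.X i)) =
      PowerSeries.C (LinearMap.mulLeft ℂ (MvPolynomial.X i)) * annihilationSeries μ +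
        (-μ) • PowerSeries.X ^ (i + 1) := by
    ext1 k
    rw [map_add, PowerSeries.coeff_mul_C, PowerSeries.coeff_C_mul, PowerSeries.coeff_smul,
      PowerSeries.coeff_X_pow, annihilationSeries, PowerSeries.coeff_mk]
    cases k with
    | zero => simp
    | succ j =>
      rw [if_neg j.succ_ne_zero]
      refine LinearMap.ext fun f => ?_
      simp only [Module.End.mul_apply, LinearMap.add_apply, LinearMap.smul_apply,
        LinearMap.mulLeft_apply, oscillator_natCast_succ_mul,
        oscillator_natCast_succ_X, smul_add, add_left_inj]
      rw [add_comm, mul_smul_comm]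
      congr 1
      rcases eq_or_ne j i with rfl | hij
      · have h2 : (j : ℂ) + 1 ≠ 0 := by exact_mod_cast j.succ_ne_zero
        simp only [if_true, Module.End.one_apply, ← MvPolynomial.smul_eq_C_mul, smul_smul]
        push_cast
        rw [div_mul_cancel₀ _ h2]
      · simp [hij]
  have key := LinearMap.congr_fun (expCoeff_mul_of_commutator hb i.succ_pos h l) f
  simp only [Module.End.mul_apply, LinearMap.mulLeft_apply, LinearMap.add_apply] at key
  rw [annihilCoeff_natCast, key, sub_eq_add_neg]
  congr 1
  split_ifs with hi
  · have hc : ((l - (i + 1) : ℕ) : ℤ) = (l : ℤ) - (i + 1) := by omega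
    rw [← hc, annihilCoeff_natCast]
    simp
  · rw [annihilCoeff_of_neg μ (by omega)]
    simp

theorem oscillator_natCast_succ_comm (i j : ℕ) (f : Fock) :
    oscillator ((i + 1 : ℕ) : ℤ) (oscillator ((j + 1 : ℕ) : ℤ) f) =
      oscillator ((j + 1 : ℕ) : ℤ) (oscillator ((i + 1 : ℕ) : ℤ) f) := by
  suffices h : MvPolynomial.pderiv i (MvPolynomial.pderiv j f) =
      MvPolynomial.pderiv j (MvPolynomial.pderiv i f) by
    change ((i : ℂ) + 1) • MvPolynomial.pderiv i (((j : ℂ) + 1) • MvPolynomial.pderiv j f) =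
      ((j : ℂ) + 1) • MvPolynomial.pderiv j (((i : ℂ) + 1) • MvPolynomial.pderiv i f)
    rw [Derivation.map_smul, Derivation.map_smul, smul_comm, h]
  ext s
  simp only [MvPolynomial.coeff_pderiv, Finsupp.add_apply]
  rcases eq_or_ne i j with rfl | h
  · rfl
  · rw [add_right_comm, Finsupp.single_eq_of_ne h, Finsupp.single_eq_of_ne h.symm]
    push_cast
    ring

theorem annihilCoeff_oscillator (μ : ℂ) (i : ℕ) (l : ℤ) (f : Fock) :
    annihilCoeff μ l (oscillator ((i + 1 : ℕ) : ℤ) f) =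
      oscillator ((i + 1 : ℕ) : ℤ) (annihilCoeff μ l f) := by
  rcases lt_or_ge l 0 with hl | hl
  · simp [annihilCoeff_of_neg μ hl]
  lift l to ℕ using hl
  rw [annihilCoeff_natCast]
  suffices h : Commute (expCoeff (annihilationSeries μ) l) (oscillator ((i + 1 : ℕ) : ℤ)) from
    LinearMap.congr_fun h.eq f
  refine expCoeff_commute (fun k => ?_) l
  rw [annihilationSeries, PowerSeries.coeff_mk]
  cases k with
  | zero => simp
  | succ j =>
    rw [if_neg j.succ_ne_zero]
    have h : Commute (oscillator ((j + 1 : ℕ) : ℤ)) (oscillator ((i + 1 : ℕ) : ℤ)) :=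
      LinearMap.ext fun f => oscillator_natCast_succ_comm j i f
    exact h.smul_left _

/-- Substitution of `xᵢ - μ zⁱ⁺¹` for `xᵢ`. -/
def shiftHom (μ : ℂ) : Fock →ₐ[ℂ] PowerSeries Fock :=
  MvPolynomial.aeval fun i =>
    PowerSeries.C (MvPolynomial.X i) - μ • (PowerSeries.X : PowerSeries Fock) ^ (i + 1)

/-- Taylor's formula: the exponential of a constant vector field is a translation. As a generating
series the annihilation part is thus multiplicative, which controls it on products of `vertexPoly`s.
-/
theorem coeff_shiftHom (μ : ℂ) (l : ℕ) (f : Fock) :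
    PowerSeries.coeff l (shiftHom μ f) = annihilCoeff μ l f := by
  induction f using MvPolynomial.induction_on generalizing l with
  | C a =>
    rw [shiftHom, MvPolynomial.aeval_C, ← mul_one (MvPolynomial.C a), ← MvPolynomial.smul_eq_C_mul,
      map_smul, Algebra.algebraMap_eq_smul_one, PowerSeries.coeff_smul, PowerSeries.coeff_one]
    rcases Nat.eq_zero_or_pos l with rfl | hl
    · rw [Nat.cast_zero, annihilCoeff_zero]
      simp
    · rw [annihilCoeff_one μ (by omega), if_neg hl.ne']
  | add p q hp hq => rw [map_add, map_add, map_add, hp, hq]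
  | mul_X p i hp =>
    rw [map_mul, mul_comm p, annihilCoeff_X_mul, mul_comm, ← hp l]
    have h : shiftHom μ (MvPolynomial.X i) = PowerSeries.C (MvPolynomial.X i) -
        μ • (PowerSeries.X : PowerSeries Fock) ^ (i + 1) := by
      rw [shiftHom, MvPolynomial.aeval_X]
    rw [h, sub_mul, map_sub, PowerSeries.coeff_C_mul, smul_mul_assoc, PowerSeries.coeff_smul,
      PowerSeries.coeff_X_pow_mul']
    congr 2
    split_ifs with hi
    · have hc : ((l - (i + 1) : ℕ) : ℤ) = (l : ℤ) - (i + 1) := by omega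
      rw [hp, hc]
    · rw [annihilCoeff_of_neg μ (by omega), LinearMap.zero_apply]

/-! ### Identities among the coefficients of exponentials -/

/-- Newton's identity. -/
theorem smul_vertexPoly (μ : ℂ) (N : ℕ) {n : ℤ} (hn : n ≤ N) :
    (n : ℂ) • vertexPoly μ n =
      μ • ∑ i ∈ Finset.range N, MvPolynomial.X i * vertexPoly μ (n - 1 - i) := by
  suffices H : ∀ k : ℕ, ∀ n : ℤ, n < k → n ≤ N → (n : ℂ) • vertexPoly μ n =
      μ • ∑ i ∈ Finset.range N, MvPolynomial.X i * vertexPoly μ (n - 1 - i) from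
    H (n.toNat + 1) n (by omega) hn
  intro k
  induction k with
  | zero =>
    intro n h _
    rw [vertexPoly_of_neg μ (by omega), smul_zero, Finset.sum_eq_zero, smul_zero]
    intro i _
    rw [vertexPoly_of_neg μ (by omega), mul_zero]
  | succ k ih =>
    intro n hnk hnN
    refine eq_of_oscillator_eq (fun t => ?_) ?_
    · rw [map_smul, map_smul, map_sum, oscillator_vertexPoly]
      simp only [oscillator_natCast_succ_mul, oscillator_vertexPoly, oscillator_natCast_succ_X,
        mul_smul_comm, Finset.sum_add_distrib, ite_mul, zero_mul, Finset.sum_ite_eq,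
        ← MvPolynomial.smul_eq_C_mul, ← Finset.smul_sum]
      -- The oscillator of index t + 1 turns the claim for n into the claim for n - (t + 1);
      -- differentiating x_t supplies the missing t + 1.
      have h1 := ih (n - (t + 1)) (by omega) (by omega)
      have h2 : ∀ i : ℕ, n - 1 - (i : ℤ) - (t + 1) = n - (t + 1) - 1 - i := fun i => by ring
      simp only [h2]
      rw [← h1, smul_comm]
      congr 1
      split_ifs with ht
      · rw [sub_right_comm, show n - (t : ℤ) - 1 = n - (t + 1) by ring, ← add_smul]
        congr 1
        push_cast
        ring
      -- Here t ≥ N ≥ n, so x_t does not occur in the sum and the shifted coefficient has negative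
      -- index.
      · rw [Finset.mem_range] at ht
        rw [vertexPoly_of_neg μ (by omega)]
        simp
    · have h1 : MvPolynomial.constantCoeff ((n : ℂ) • vertexPoly μ n) = 0 := by
        rcases eq_or_ne n 0 with rfl | h
        · simp
        · rw [MvPolynomial.constantCoeff_smul, constantCoeff_vertexPoly μ h, smul_zero]
      rw [h1, MvPolynomial.constantCoeff_smul, map_sum, Finset.sum_eq_zero, smul_zero]
      intro i _
      simp

/-- The constant term of `annihilCoeff μ l (vertexPoly ν p)` satisfies a recursion. -/
theorem constantCoeff_annihilCoeff_vertexPoly_rec (μ ν : ℂ) (N : ℕ) (l : ℤ) {p : ℤ} (hp : p ≤ N) :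
    (p : ℂ) * MvPolynomial.constantCoeff (annihilCoeff μ l (vertexPoly ν p)) =
      -(μ * ν) * ∑ i ∈ Finset.range N, MvPolynomial.constantCoeff
        (annihilCoeff μ (l - 1 - i) (vertexPoly ν (p - 1 - i))) := by
  have h := congrArg (fun f => MvPolynomial.constantCoeff (annihilCoeff μ l f))
    (smul_vertexPoly ν N hp)
  simp only [map_smul, map_sum, annihilCoeff_X_mul, MvPolynomial.constantCoeff_smul, map_sub,
    map_mul, MvPolynomial.constantCoeff_X, zero_mul, zero_sub, smul_eq_mul] at h
  rw [h, Finset.mul_sum, Finset.mul_sum]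
  refine Finset.sum_congr rfl fun i _ => ?_
  rw [show l - ((i : ℤ) + 1) = l - 1 - i by ring]
  ring

/-- Homogeneity: the recursion lowers l and p by the same amount, so p - l never becomes 0. -/
theorem constantCoeff_annihilCoeff_vertexPoly_of_ne (μ ν : ℂ) {l p : ℤ} (h : p ≠ l) :
    MvPolynomial.constantCoeff (annihilCoeff μ l (vertexPoly ν p)) = 0 := by
  suffices H : ∀ k : ℕ, ∀ l p : ℤ, p < k → p ≠ l →
      MvPolynomial.constantCoeff (annihilCoeff μ l (vertexPoly ν p)) = 0 from
    H (p.toNat + 1) l p (by omega) h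
  intro k
  induction k with
  | zero =>
    intro l p hp _
    rw [vertexPoly_of_neg ν (by omega), map_zero, map_zero]
  | succ k ih =>
    intro l p hp hpl
    rcases lt_trichotomy p 0 with h0 | h0 | h0
    · rw [vertexPoly_of_neg ν h0, map_zero, map_zero]
    · rw [h0, vertexPoly_zero, annihilCoeff_one μ (by omega), map_zero]
    · have h1 := constantCoeff_annihilCoeff_vertexPoly_rec μ ν p.toNat l (p := p) (by omega)
      rw [Finset.sum_eq_zero fun i _ => ih _ _ (by omega) (by omega), mul_zero] at h1
      exact (mul_eq_zero.1 h1).resolve_left (by exact_mod_cast h0.ne')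

/-- The annihilation part commutes with positive oscillators, so it preserves the eigenvector
property of the creation series; constant terms, nonzero only for p = l, fix the scalar. -/
theorem annihilCoeff_vertexPoly (μ ν : ℂ) (l p : ℤ) :
    annihilCoeff μ l (vertexPoly ν p) =
      MvPolynomial.constantCoeff (annihilCoeff μ l (vertexPoly ν l)) • vertexPoly ν (p - l) := by
  suffices H : ∀ k : ℕ, ∀ p : ℤ, p < k → annihilCoeff μ l (vertexPoly ν p) =
      MvPolynomial.constantCoeff (annihilCoeff μ l (vertexPoly ν l)) • vertexPoly ν (p - l) from
    H (p.toNat + 1) p (by omega)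
  intro k
  induction k with
  | zero =>
    intro p hp
    rw [vertexPoly_of_neg ν (by omega), map_zero]
    rcases lt_or_ge l 0 with h | h
    · simp [annihilCoeff_of_neg μ h]
    · rw [vertexPoly_of_neg ν (show p - l < 0 by omega), smul_zero]
  | succ k ih =>
    intro p hp
    refine eq_of_oscillator_eq (fun t => ?_) ?_
    · rw [← annihilCoeff_oscillator, oscillator_vertexPoly, map_smul, map_smul,
        oscillator_vertexPoly, ih _ (by omega), smul_comm, sub_right_comm]
    · rw [MvPolynomial.constantCoeff_smul]
      rcases eq_or_ne p l with rfl | h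
      · rw [sub_self, vertexPoly_zero, map_one, smul_eq_mul, mul_one]
      · rw [constantCoeff_annihilCoeff_vertexPoly_of_ne μ ν h,
          constantCoeff_vertexPoly ν (by omega), smul_zero]

/-- The numbers by which an annihilation part scales a creation part follow the recursion of the
coefficients of `(1 - z) ^ (μ ν)`. -/
theorem constantCoeff_annihilCoeff_vertexPoly_succ (μ ν : ℂ) (l : ℕ) :
    (l + 1 : ℂ) * MvPolynomial.constantCoeff
        (annihilCoeff μ (l + 1 : ℕ) (vertexPoly ν (l + 1 : ℕ))) =
      (l - μ * ν) * MvPolynomial.constantCoeff (annihilCoeff μ l (vertexPoly ν l)) := by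
  have key : ∀ m : ℕ, (m : ℂ) * MvPolynomial.constantCoeff (annihilCoeff μ m (vertexPoly ν m)) =
      -(μ * ν) * ∑ i ∈ Finset.range m,
        MvPolynomial.constantCoeff (annihilCoeff μ i (vertexPoly ν i)) := by
    intro m
    have h := constantCoeff_annihilCoeff_vertexPoly_rec μ ν m m (p := m) le_rfl
    rw [← Finset.sum_range_reflect]
    rw [Int.cast_natCast] at h
    rw [h]
    congr 1
    refine Finset.sum_congr rfl fun i hi => ?_
    rw [Finset.mem_range] at hi
    rw [show ((m - 1 - i : ℕ) : ℤ) = (m : ℤ) - 1 - i by omega]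
  -- Subtracting the summed recursion for l from that for l + 1 leaves a two-term recursion.
  have h1 := key (l + 1)
  rw [Finset.sum_range_succ, mul_add, ← key l] at h1
  push_cast at h1 ⊢
  rw [h1]
  ring

/-! ### Vertex operators on a Fock space -/

theorem finite_support_annihilCoeff (μ : ℂ) (f : Fock) :
    {l : ℤ | annihilCoeff μ l f ≠ 0}.Finite := by
  refine ((finite_support_annihilation μ f).image Nat.cast).subset fun l hl => ?_
  rcases lt_or_ge l 0 with h | h
  · exact absurd (by rw [annihilCoeff_of_neg μ h, LinearMap.zero_apply]) hl
  lift l to ℕ using h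
  exact ⟨l, by simpa only [Set.mem_ofPred_eq, annihilCoeff_natCast] using hl, rfl⟩

theorem finite_support_mul_annihilCoeff (μ : ℂ) (g : ℤ → Fock) (f : Fock) :
    (Function.support fun l : ℤ => g l * annihilCoeff μ l f).Finite := by
  refine (finite_support_annihilCoeff μ f).subset fun l hl h0 => hl ?_
  simp only [h0, mul_zero]

/-- Both factors vanish at negative index, so the case distinction disappears and the sum over ℤ can
be reindexed by translations. -/
theorem fockVertexCoeff_apply (μ : ℂ) (d : ℤ) (f : Fock) :
    fockVertexCoeff μ d f = ∑ᶠ l : ℤ, vertexPoly μ (d + l) * annihilCoeff μ l f := by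
  have h1 : ∑ᶠ l : ℤ, vertexPoly μ (d + l) * annihilCoeff μ l f =
      ∑ᶠ l ∈ Set.range (Nat.cast : ℕ → ℤ), vertexPoly μ (d + l) * annihilCoeff μ l f := by
    rw [← finsum_mem_univ]
    refine finsum_mem_inter_support_eq' _ _ _ fun l hl => ⟨fun _ => ?_, fun _ => trivial⟩
    rcases lt_or_ge l 0 with h | h
    · exact absurd (by simp only [annihilCoeff_of_neg μ h, LinearMap.zero_apply, mul_zero]) hl
    · exact ⟨l.toNat, Int.toNat_of_nonneg h⟩
  rw [h1, finsum_mem_range Nat.cast_injective]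
  change (∑ᶠ l : ℕ, _) = _
  refine finsum_congr fun l => ?_
  split_ifs with h
  · rw [expCoeff_creationSeries, LinearMap.mulLeft_apply, annihilCoeff_natCast,
      Int.toNat_of_nonneg h]
  · rw [vertexPoly_of_neg μ (not_le.1 h), zero_mul]

theorem fockVertexCoeff_one (μ : ℂ) (d : ℤ) : fockVertexCoeff μ d 1 = vertexPoly μ d := by
  rw [fockVertexCoeff_apply, finsum_eq_single _ 0 fun l hl =>
      by rw [annihilCoeff_one μ hl, mul_zero],
    annihilCoeff_zero, add_zero, Module.End.one_apply, mul_one]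

theorem fockVertexCoeff_X_mul (μ : ℂ) (d : ℤ) (i : ℕ) (f : Fock) :
    fockVertexCoeff μ d (MvPolynomial.X i * f) =
      MvPolynomial.X i * fockVertexCoeff μ d f - μ • fockVertexCoeff μ (d + (i + 1)) f := by
  have h : fockVertexCoeff μ (d + (i + 1)) f =
      ∑ᶠ l : ℤ, vertexPoly μ (d + l) * annihilCoeff μ (l - (i + 1)) f := by
    rw [fockVertexCoeff_apply]
    refine Eq.trans (finsum_congr fun l => ?_) (finsum_comp_equiv (Equiv.addRight ((i : ℤ) + 1)))
    rw [Equiv.coe_addRight, add_sub_cancel_right, add_assoc, add_comm ((i : ℤ) + 1)]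
  have hs : (Function.support fun l : ℤ =>
      vertexPoly μ (d + l) * annihilCoeff μ (l - (i + 1)) f).Finite := by
    refine ((finite_support_annihilCoeff μ f).preimage
      (sub_left_injective (b := (i : ℤ) + 1)).injOn).subset fun l hl h0 => hl ?_
    simp only [h0, mul_zero]
  rw [h, fockVertexCoeff_apply, fockVertexCoeff_apply, mul_finsum, smul_finsum,
    ← finsum_sub_distrib]
  · refine finsum_congr fun l => ?_
    rw [annihilCoeff_X_mul, mul_sub, mul_smul_comm, mul_left_comm]
  · refine (finite_support_mul_annihilCoeff μ (fun l => vertexPoly μ (d + l)) f).subset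
      fun l hl h0 => hl ?_
    simp only [h0, mul_zero]
  · refine hs.subset fun l hl h0 => hl ?_
    simp only [h0, smul_zero]

theorem oscillator_fockVertexCoeff_of_pos (μ : ℂ) (d : ℤ) (i : ℕ) (f : Fock) :
    oscillator ((i + 1 : ℕ) : ℤ) (fockVertexCoeff μ d f) =
      fockVertexCoeff μ d (oscillator ((i + 1 : ℕ) : ℤ) f) +
        μ • fockVertexCoeff μ (d - (i + 1)) f := by
  rw [fockVertexCoeff_apply, fockVertexCoeff_apply, fockVertexCoeff_apply, smul_finsum,
    ← finsum_add_distrib (finite_support_mul_annihilCoeff μ _ _)]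
  · refine (AddMonoidHom.map_finsum (oscillator ((i + 1 : ℕ) : ℤ)).toAddMonoidHom
      (finite_support_mul_annihilCoeff μ _ _)).trans (finsum_congr fun l => ?_)
    change oscillator ((i + 1 : ℕ) : ℤ) _ = _
    rw [oscillator_natCast_succ_mul, annihilCoeff_oscillator, oscillator_vertexPoly, add_comm,
      smul_mul_assoc, sub_add_eq_add_sub]
  · refine (finite_support_mul_annihilCoeff μ (fun l => vertexPoly μ (d - (i + 1) + l)) f).subset
      fun l hl h0 => hl ?_
    simp only [h0, smul_zero]

/-- For k < 0 the extra term comes from the annihilation part, for k > 0 from the creation part; the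
resulting formula is the same. -/
theorem oscillator_fockVertexCoeff (μ : ℂ) (d : ℤ) {k : ℤ} (hk : k ≠ 0) (f : Fock) :
    oscillator k (fockVertexCoeff μ d f) =
      fockVertexCoeff μ d (oscillator k f) + μ • fockVertexCoeff μ (d - k) f := by
  rcases lt_or_gt_of_ne hk with h | h
  · obtain ⟨i, rfl⟩ : ∃ i : ℕ, k = -((i + 1 : ℕ) : ℤ) := ⟨(-k - 1).toNat, by omega⟩
    rw [oscillator_neg_succ, LinearMap.mulLeft_apply, LinearMap.mulLeft_apply,
      fockVertexCoeff_X_mul, sub_neg_eq_add]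
    push_cast
    abel
  · obtain ⟨i, rfl⟩ : ∃ i : ℕ, k = ((i + 1 : ℕ) : ℤ) := ⟨(k - 1).toNat, by omega⟩
    rw [oscillator_fockVertexCoeff_of_pos]
    push_cast
    rfl

theorem oscillator_lie (n m : ℤ) (f : Fock) :
    oscillator n (oscillator m f) = oscillator m (oscillator n f) +
      (if n + m = 0 then (n : ℂ) else 0) • f := by
  have key : ∀ (i : ℕ) (m : ℤ), oscillator ((i + 1 : ℕ) : ℤ) (oscillator m f) =
      oscillator m (oscillator ((i + 1 : ℕ) : ℤ) f) +
        (if ((i + 1 : ℕ) : ℤ) + m = 0 then (((i + 1 : ℕ) : ℤ) : ℂ) else 0) • f := by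
    intro i m
    rcases lt_trichotomy m 0 with h | rfl | h
    · obtain ⟨j, rfl⟩ : ∃ j : ℕ, m = -((j + 1 : ℕ) : ℤ) := ⟨(-m - 1).toNat, by omega⟩
      rw [oscillator_neg_succ, LinearMap.mulLeft_apply, LinearMap.mulLeft_apply,
        oscillator_natCast_succ_mul, oscillator_natCast_succ_X, add_comm]
      congr 1
      rcases eq_or_ne i j with rfl | hij
      · simp [MvPolynomial.smul_eq_C_mul]
      · rw [if_neg hij, if_neg (by omega), zero_mul, zero_smul]
    · have h0 : oscillator 0 = 0 := rfl
      rw [h0, if_neg (by omega)]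
      simp
    · obtain ⟨j, rfl⟩ : ∃ j : ℕ, m = ((j + 1 : ℕ) : ℤ) := ⟨(m - 1).toNat, by omega⟩
      rw [oscillator_natCast_succ_comm, if_neg (by omega), zero_smul, add_zero]
  rcases lt_trichotomy n 0 with h | rfl | h
  · obtain ⟨i, rfl⟩ : ∃ i : ℕ, n = -((i + 1 : ℕ) : ℤ) := ⟨(-n - 1).toNat, by omega⟩
    rcases lt_trichotomy m 0 with h' | rfl | h'
    · obtain ⟨j, rfl⟩ : ∃ j : ℕ, m = -((j + 1 : ℕ) : ℤ) := ⟨(-m - 1).toNat, by omega⟩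
      rw [oscillator_neg_succ, oscillator_neg_succ, if_neg (by omega)]
      simp only [LinearMap.mulLeft_apply, zero_smul, add_zero]
      rw [mul_left_comm]
    · have h0 : oscillator 0 = 0 := rfl
      rw [h0, if_neg (by omega)]
      simp
    · obtain ⟨j, rfl⟩ : ∃ j : ℕ, m = ((j + 1 : ℕ) : ℤ) := ⟨(m - 1).toNat, by omega⟩
      rw [key j, add_assoc, ← add_smul, add_comm (-((i + 1 : ℕ) : ℤ))]
      split_ifs with hij
      · rw [show ((j + 1 : ℕ) : ℤ) = ((i + 1 : ℕ) : ℤ) by omega]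
        simp
      · simp
  · have h0 : oscillator 0 = 0 := rfl
    rw [h0]
    simp
  · obtain ⟨i, rfl⟩ : ∃ i : ℕ, n = ((i + 1 : ℕ) : ℤ) := ⟨(n - 1).toNat, by omega⟩
    exact key i m

/-! ### Vertex operators applied to the coefficients of exponentials -/

/-- These are the coefficients 1, -2, 1 of (1 - z)²; the factor l - 2 of the recursion vanishes at l
= 2 and stops the series. -/
theorem constantCoeff_annihilCoeff_vertexPoly_of_mul_eq_two {μ ν : ℂ} (h : μ * ν = 2) :
    MvPolynomial.constantCoeff (annihilCoeff μ 1 (vertexPoly ν 1)) = -2 ∧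
    MvPolynomial.constantCoeff (annihilCoeff μ 2 (vertexPoly ν 2)) = 1 ∧
    ∀ l : ℤ, 3 ≤ l → MvPolynomial.constantCoeff (annihilCoeff μ l (vertexPoly ν l)) = 0 := by
  have h0 : MvPolynomial.constantCoeff (annihilCoeff μ 0 (vertexPoly ν 0)) = 1 := by
    rw [annihilCoeff_zero, vertexPoly_zero, Module.End.one_apply, map_one]
  have h1 := constantCoeff_annihilCoeff_vertexPoly_succ μ ν 0
  have h2 := constantCoeff_annihilCoeff_vertexPoly_succ μ ν 1
  have h3 := constantCoeff_annihilCoeff_vertexPoly_succ μ ν 2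
  rw [h] at h1 h2 h3
  norm_num at h1 h2 h3
  rw [h0] at h1
  rw [h1] at h2
  refine ⟨by linear_combination h1, by linear_combination h2 / 2, fun l hl => ?_⟩
  lift l to ℕ using by omega
  induction l with
  | zero => omega
  | succ l ih =>
    rcases eq_or_ne l 2 with rfl | hl2
    · exact h3
    · have h4 := constantCoeff_annihilCoeff_vertexPoly_succ μ ν l
      rw [ih (by omega), mul_zero] at h4
      exact (mul_eq_zero.1 h4).resolve_left (Nat.cast_add_one_ne_zero l)

theorem constantCoeff_annihilCoeff_vertexPoly_of_mul_eq_neg_two {μ ν : ℂ} (h : μ * ν = -2)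
    (l : ℕ) : MvPolynomial.constantCoeff (annihilCoeff μ l (vertexPoly ν l)) = l + 1 := by
  induction l with
  | zero =>
    rw [Nat.cast_zero, annihilCoeff_zero, vertexPoly_zero, Module.End.one_apply, map_one,
      Nat.cast_zero, zero_add]
  | succ l ih =>
    have h4 := constantCoeff_annihilCoeff_vertexPoly_succ μ ν l
    rw [ih, h] at h4
    have h5 : (l : ℂ) + 1 ≠ 0 := Nat.cast_add_one_ne_zero l
    refine mul_left_cancel₀ h5 (h4.trans ?_)
    push_cast
    ring

theorem annihilCoeff_vertexPoly_one {μ ν : ℂ} (h : μ * ν = 2) (p : ℤ) :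
    annihilCoeff μ 1 (vertexPoly ν p) = (-2 : ℂ) • vertexPoly ν (p - 1) := by
  rw [annihilCoeff_vertexPoly, (constantCoeff_annihilCoeff_vertexPoly_of_mul_eq_two h).1]

theorem annihilCoeff_vertexPoly_two {μ ν : ℂ} (h : μ * ν = 2) (p : ℤ) :
    annihilCoeff μ 2 (vertexPoly ν p) = vertexPoly ν (p - 2) := by
  rw [annihilCoeff_vertexPoly, (constantCoeff_annihilCoeff_vertexPoly_of_mul_eq_two h).2.1,
    one_smul]

theorem annihilCoeff_vertexPoly_of_three_le {μ ν : ℂ} (h : μ * ν = 2) {l : ℤ} (hl : 3 ≤ l)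
    (p : ℤ) : annihilCoeff μ l (vertexPoly ν p) = 0 := by
  rw [annihilCoeff_vertexPoly, (constantCoeff_annihilCoeff_vertexPoly_of_mul_eq_two h).2.2 l hl,
    zero_smul]

theorem fockVertexCoeff_vertexPoly_of_mul_eq_two {μ ν : ℂ} (h : μ * ν = 2) (d p : ℤ) :
    fockVertexCoeff μ d (vertexPoly ν p) = vertexPoly μ d * vertexPoly ν p
      - (2 : ℂ) • (vertexPoly μ (d + 1) * vertexPoly ν (p - 1))
      + vertexPoly μ (d + 2) * vertexPoly ν (p - 2) := by
  rw [fockVertexCoeff_apply, finsum_eq_sum_of_support_subset (s := {0, 1, 2})]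
  · rw [Finset.sum_insert (by decide), Finset.sum_insert (by decide), Finset.sum_singleton,
      annihilCoeff_zero, annihilCoeff_vertexPoly_one h, annihilCoeff_vertexPoly_two h, add_zero,
      Module.End.one_apply, mul_smul_comm, neg_smul]
    abel
  · intro l hl
    by_contra hl'
    apply hl
    rcases lt_or_ge l 0 with h0 | h0
    · simp only [annihilCoeff_of_neg μ h0, LinearMap.zero_apply, mul_zero]
    · have h3 : 3 ≤ l := by
        simp at hl'
        omega
      simp only [annihilCoeff_vertexPoly_of_three_le h h3, mul_zero]

/-- The factor (1 - w/z)² = z⁻²(z - w)² is symmetric in z and w up to z⁻², hence the shifts by 2. -/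
theorem fockVertexCoeff_vertexPoly_comm {μ : ℂ} (h : μ * μ = 2) (d p : ℤ) :
    fockVertexCoeff μ d (vertexPoly μ p) = fockVertexCoeff μ (p - 2) (vertexPoly μ (d + 2)) := by
  rw [fockVertexCoeff_vertexPoly_of_mul_eq_two h, fockVertexCoeff_vertexPoly_of_mul_eq_two h,
    show p - 2 + 1 = p - 1 by ring, show p - 2 + 2 = p by ring, show d + 2 - 1 = d + 1 by ring,
    show d + 2 - 2 = d by ring, mul_comm (vertexPoly μ (p - 2)), mul_comm (vertexPoly μ (p - 1)),
    mul_comm (vertexPoly μ p)]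
  abel

/-- The coefficients l + 1 of (1 - z)⁻², reindexed by i = d + l so that the two orders of e and f
become sums over the same products. -/
theorem fockVertexCoeff_vertexPoly_of_mul_eq_neg_two {μ ν : ℂ} (h : μ * ν = -2) (d p : ℤ) :
    fockVertexCoeff μ d (vertexPoly ν p) = ∑ᶠ i : ℤ,
      (if d ≤ i then (i - d + 1 : ℂ) else 0) • (vertexPoly μ i * vertexPoly ν (d + p - i)) := by
  rw [fockVertexCoeff_apply]
  refine Eq.trans (finsum_congr fun l => ?_) (finsum_comp_equiv (Equiv.addLeft d))
  rw [show Equiv.addLeft d l = d + l from rfl]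
  rcases lt_or_ge l 0 with h0 | h0
  · rw [annihilCoeff_of_neg μ h0, if_neg (by omega), LinearMap.zero_apply, mul_zero, zero_smul]
  · rw [if_pos (by omega), annihilCoeff_vertexPoly, mul_smul_comm]
    lift l to ℕ using h0
    rw [constantCoeff_annihilCoeff_vertexPoly_of_mul_eq_neg_two h,
      show d + p - (d + l) = p - l by ring]
    congr 1
    push_cast
    ring

/-! ### Sums of products of opposite creation coefficients -/

theorem finite_support_vertexPoly_mul (μ ν : ℂ) (c : ℤ → ℂ) (a N : ℤ) :
    (Function.support fun i : ℤ =>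
      c i • (vertexPoly μ (i - a) * vertexPoly ν (N - i))).Finite := by
  refine (Set.finite_Icc a N).subset fun i hi => ?_
  by_contra h
  apply hi
  rw [Set.mem_Icc, not_and_or] at h
  rcases h with h | h
  · simp only [vertexPoly_of_neg μ (show i - a < 0 by omega), zero_mul, smul_zero]
  · simp only [vertexPoly_of_neg ν (show N - i < 0 by omega), mul_zero, smul_zero]

theorem hasFiniteSupport_vertexPoly_mul (μ ν : ℂ) (c : ℤ → ℂ) (N : ℤ) :
    Function.HasFiniteSupport fun i : ℤ => c i • (vertexPoly μ i * vertexPoly ν (N - i)) := by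
  have h := finite_support_vertexPoly_mul μ ν c 0 N
  simp only [sub_zero] at h
  exact h

theorem map_finsum_vertexPoly_mul (φ : Fock →+ Fock) (μ ν : ℂ) (c : ℤ → ℂ) (N : ℤ) :
    φ (∑ᶠ i : ℤ, c i • (vertexPoly μ i * vertexPoly ν (N - i))) =
      ∑ᶠ i : ℤ, φ (c i • (vertexPoly μ i * vertexPoly ν (N - i))) := by
  exact AddMonoidHom.map_finsum _ (hasFiniteSupport_vertexPoly_mul μ ν c N)

/-- One factor is shifted with coefficient μ, the other with -μ, so the oscillator acts on the
weight c by a finite difference: constant weights are killed and linear ones become constant. -/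
theorem oscillator_finsum_vertexPoly (μ : ℂ) (c : ℤ → ℂ) (N : ℤ) (t : ℕ) :
    oscillator ((t + 1 : ℕ) : ℤ)
        (∑ᶠ i : ℤ, c i • (vertexPoly μ i * vertexPoly (-μ) (N - i))) =
      μ • ∑ᶠ i : ℤ, (c (i + (t + 1)) - c i) •
        (vertexPoly μ i * vertexPoly (-μ) (N - (t + 1) - i)) := by
  have h1 : ∑ᶠ i : ℤ, c (i + (t + 1)) • (vertexPoly μ i * vertexPoly (-μ) (N - (t + 1) - i)) =
      ∑ᶠ i : ℤ, c i • (vertexPoly μ (i - (t + 1)) * vertexPoly (-μ) (N - i)) := by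
    refine Eq.trans (finsum_congr fun i => ?_) (finsum_comp_equiv (Equiv.addRight ((t : ℤ) + 1)))
    rw [Equiv.coe_addRight, add_sub_cancel_right, show N - (i + ((t : ℤ) + 1)) = N - (t + 1) - i by
      ring]
  simp only [sub_smul]
  have hfin := fun (c : ℤ → ℂ) => hasFiniteSupport_vertexPoly_mul μ (-μ) c (N - (t + 1))
  rw [finsum_sub_distrib (hfin fun i => c (i + (t + 1))) (hfin c), h1, ← finsum_sub_distrib
    (finite_support_vertexPoly_mul _ _ _ _ _) (hfin c), smul_finsum]
  refine (map_finsum_vertexPoly_mul (oscillator ((t + 1 : ℕ) : ℤ)).toAddMonoidHom _ _ _ _).trans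
    (finsum_congr fun i => ?_)
  change oscillator ((t + 1 : ℕ) : ℤ) _ = _
  rw [map_smul, oscillator_natCast_succ_mul, oscillator_vertexPoly, oscillator_vertexPoly,
    sub_right_comm N i, smul_mul_assoc, mul_smul_comm, neg_smul, ← sub_eq_add_neg, ← smul_sub,
    smul_comm, smul_sub]

theorem constantCoeff_finsum_vertexPoly (μ : ℂ) (c : ℤ → ℂ) (N : ℤ) :
    MvPolynomial.constantCoeff (∑ᶠ i : ℤ, c i • (vertexPoly μ i * vertexPoly (-μ) (N - i))) =
      if N = 0 then c 0 else 0 := by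
  have h := AddMonoidHom.map_finsum
    (MvPolynomial.constantCoeff : Fock →+* ℂ).toAddMonoidHom
    (f := fun i : ℤ => c i • (vertexPoly μ i * vertexPoly (-μ) (N - i)))
    (hasFiniteSupport_vertexPoly_mul μ (-μ) c N)
  refine h.trans ?_
  change ∑ᶠ i : ℤ, MvPolynomial.constantCoeff _ = _
  simp only [MvPolynomial.constantCoeff_smul, map_mul]
  rw [finsum_eq_single _ 0 fun i hi => by rw [constantCoeff_vertexPoly μ hi, zero_mul, smul_zero]]
  rw [vertexPoly_zero, map_one, one_mul, sub_zero]
  split_ifs with hN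
  · rw [hN, vertexPoly_zero, map_one, smul_eq_mul, mul_one]
  · rw [constantCoeff_vertexPoly _ hN, smul_zero]

/-- The creation exponentials for μ and -μ are inverse to each other. -/
theorem finsum_vertexPoly_mul (μ : ℂ) (N : ℤ) :
    ∑ᶠ i : ℤ, vertexPoly μ i * vertexPoly (-μ) (N - i) = if N = 0 then 1 else 0 := by
  have h := fun t => oscillator_finsum_vertexPoly μ (fun _ => 1) N t
  have h' := constantCoeff_finsum_vertexPoly μ (fun _ => 1) N
  simp only [sub_self, zero_smul, finsum_zero, smul_zero, one_smul] at h h'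
  refine eq_of_oscillator_eq (fun t => ?_) ?_
  · rw [h]
    split_ifs
    · rw [oscillator_natCast_succ_one]
    · rw [map_zero]
  · rw [h']
    split_ifs <;> simp

/-- The logarithmic derivative of the creation exponential E: z E′ E⁻¹ = μ ∑ x_{n-1} zⁿ. -/
theorem finsum_smul_vertexPoly_mul (μ : ℂ) (N : ℤ) :
    ∑ᶠ i : ℤ, (i : ℂ) • (vertexPoly μ i * vertexPoly (-μ) (N - i)) =
      μ • if 0 < N then MvPolynomial.X (N - 1).toNat else 0 := by
  refine eq_of_oscillator_eq (fun t => ?_) ?_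
  · rw [oscillator_finsum_vertexPoly, map_smul]
    congr 1
    have h : ∀ i : ℤ, ((i + (t + 1) : ℤ) : ℂ) - (i : ℂ) = (t : ℂ) + 1 := fun i => by
      push_cast
      ring
    simp only [h]
    rw [← smul_finsum, finsum_vertexPoly_mul]
    split_ifs with h1 h2 h2
    · rw [oscillator_natCast_succ_X, if_pos (by omega), MvPolynomial.smul_eq_C_mul, mul_one]
    · omega
    · rw [oscillator_natCast_succ_X, if_neg (by omega), smul_zero]
    · rw [map_zero, smul_zero]
  · rw [constantCoeff_finsum_vertexPoly, MvPolynomial.constantCoeff_smul]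
    split_ifs <;> simp

/-- One order has weight i - d + 1 on i ≥ d, the other d - 1 - i on i ≤ d - 2. Their difference is
the single linear weight i - d + 1 on all of ℤ, and the two preceding sums apply. -/
theorem fockVertexCoeff_vertexPoly_sub {μ : ℂ} (h : μ * μ = 2) (d p : ℤ) :
    fockVertexCoeff μ d (vertexPoly (-μ) p) -
        fockVertexCoeff (-μ) (p + 2) (vertexPoly μ (d - 2)) =
      (μ • if 0 < d + p then MvPolynomial.X (d + p - 1).toNat else 0) +
        (1 - d : ℂ) • if d + p = 0 then 1 else 0 := by
  have h1 : μ * -μ = -2 := by rw [mul_neg, h]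
  have h2 : -μ * μ = -2 := by rw [neg_mul, h]
  have h3 : fockVertexCoeff (-μ) (p + 2) (vertexPoly μ (d - 2)) = ∑ᶠ i : ℤ,
      (if i ≤ d - 2 then (d - 1 - i : ℂ) else 0) •
        (vertexPoly μ i * vertexPoly (-μ) (d + p - i)) := by
    rw [fockVertexCoeff_vertexPoly_of_mul_eq_neg_two h2,
      ← finsum_comp_equiv (Equiv.subLeft (d + p))]
    refine finsum_congr fun i => ?_
    rw [Equiv.subLeft_apply, mul_comm, show p + 2 + (d - 2) - (d + p - i) = i by ring]
    split_ifs with h4 h5 h5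
    · congr 1
      push_cast
      ring
    · omega
    · omega
    · rfl
  have hfin := fun (c : ℤ → ℂ) => hasFiniteSupport_vertexPoly_mul μ (-μ) c (d + p)
  rw [h3, fockVertexCoeff_vertexPoly_of_mul_eq_neg_two h1,
    ← finsum_sub_distrib (hfin _) (hfin _), ← finsum_smul_vertexPoly_mul,
    ← finsum_vertexPoly_mul μ, smul_finsum, ← finsum_add_distrib (hfin _) (hfin _)]
  refine finsum_congr fun i => ?_
  rw [← sub_smul, ← add_smul]
  congr 1
  split_ifs with h4 h5 h5
  · omega
  · ring
  · ring
  -- The one index missing from both halves is the zero of the linear weight.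
  · have h6 : i = d - 1 := by omega
    rw [h6]
    push_cast
    ring

/-! ### Commutators of endomorphisms -/

section Commutator

variable {V : Type*} [AddCommGroup V] [Module ℂ V]

theorem commutator_add (a x y : Module.End ℂ V) : ⁅a, x + y⁆ = ⁅a, x⁆ + ⁅a, y⁆ := by
  simp only [Ring.lie_def]
  noncomm_ring

theorem add_commutator (x y a : Module.End ℂ V) : ⁅x + y, a⁆ = ⁅x, a⁆ + ⁅y, a⁆ := by
  simp only [Ring.lie_def]
  noncomm_ring

theorem commutator_sub (a x y : Module.End ℂ V) : ⁅a, x - y⁆ = ⁅a, x⁆ - ⁅a, y⁆ := by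
  simp only [Ring.lie_def]
  noncomm_ring

theorem neg_commutator (x y : Module.End ℂ V) : -⁅x, y⁆ = ⁅y, x⁆ := by
  simp only [Ring.lie_def]
  noncomm_ring

theorem commutator_leibniz (a x y : Module.End ℂ V) : ⁅a, ⁅x, y⁆⁆ = ⁅⁅a, x⁆, y⁆ + ⁅x, ⁅a, y⁆⁆ := by
  simp only [Ring.lie_def]
  noncomm_ring

theorem commutator_one (a : Module.End ℂ V) : ⁅a, (1 : Module.End ℂ V)⁆ = 0 := by
  simp [Ring.lie_def]

theorem commutator_smul (c : ℂ) (x y : Module.End ℂ V) : ⁅x, c • y⁆ = c • ⁅x, y⁆ := by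
  simp only [Ring.lie_def, mul_smul_comm, smul_mul_assoc, smul_sub]

theorem smul_commutator (c : ℂ) (x y : Module.End ℂ V) : ⁅c • x, y⁆ = c • ⁅x, y⁆ := by
  simp only [Ring.lie_def, mul_smul_comm, smul_mul_assoc, smul_sub]

end Commutator

/-! ### Commutation relations on the lattice vertex algebra -/

theorem rootTwo_mul_self : rootTwo * rootTwo = 2 := by
  rw [rootTwo, ← Complex.ofReal_mul, Real.mul_self_sqrt (by norm_num)]
  norm_num

theorem rootTwo_ne_zero : rootTwo ≠ 0 := by
  intro h
  have := rootTwo_mul_self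
  rw [h] at this
  norm_num at this

theorem heisMode_single (n j : ℤ) (f : Fock) : heisMode n (Finsupp.single j f) =
    Finsupp.single j (if n = 0 then ((j : ℂ) * rootTwo) • f else oscillator n f) := by
  rw [heisMode, Finsupp.lsum_single]
  split_ifs <;> rfl

theorem heisMode_zero_single (j : ℤ) (f : Fock) :
    heisMode 0 (Finsupp.single j f) = ((j : ℂ) * rootTwo) • Finsupp.single j f := by
  rw [heisMode_single, if_pos rfl, Finsupp.smul_single]

theorem heisMode_single_of_ne {n : ℤ} (hn : n ≠ 0) (j : ℤ) (f : Fock) :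
    heisMode n (Finsupp.single j f) = Finsupp.single j (oscillator n f) := by
  rw [heisMode_single, if_neg hn]

theorem vertexCoeff_single (ε p j : ℤ) (f : Fock) : vertexCoeff ε p (Finsupp.single j f) =
    Finsupp.single (j + ε) (fockVertexCoeff ((ε : ℂ) * rootTwo) (p - 2 * ε * j) f) := by
  rw [vertexCoeff, Finsupp.lsum_single]
  rfl

theorem eMode_single (n j : ℤ) (f : Fock) : eMode n (Finsupp.single j f) =
    Finsupp.single (j + 1) (fockVertexCoeff rootTwo (-n - 1 - 2 * j) f) := by
  rw [eMode, vertexCoeff_single, Int.cast_one, one_mul, mul_one]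

theorem fMode_single (n j : ℤ) (f : Fock) : fMode n (Finsupp.single j f) =
    Finsupp.single (j - 1) (fockVertexCoeff (-rootTwo) (-n - 1 + 2 * j) f) := by
  rw [fMode, vertexCoeff_single]
  congr 3
  · push_cast
    ring
  · ring

theorem latticeV_hom_ext {S T : Module.End ℂ LatticeV}
    (h : ∀ (j : ℤ) (f : Fock), S (Finsupp.single j f) = T (Finsupp.single j f)) : S = T :=
  Finsupp.lhom_ext h

theorem heisMode_lie_vertexCoeff (k ε p : ℤ) :
    ⁅heisMode k, vertexCoeff ε p⁆ = ((ε : ℂ) * rootTwo) • vertexCoeff ε (p - k) := by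
  refine latticeV_hom_ext fun j f => ?_
  rw [Ring.lie_def, LinearMap.sub_apply, Module.End.mul_apply, Module.End.mul_apply,
    LinearMap.smul_apply, vertexCoeff_single, vertexCoeff_single]
  rcases eq_or_ne k 0 with rfl | hk
  · rw [heisMode_zero_single, heisMode_zero_single, map_smul, vertexCoeff_single, ← sub_smul,
      sub_zero]
    congr 1
    push_cast
    ring
  · rw [heisMode_single_of_ne hk, heisMode_single_of_ne hk, vertexCoeff_single,
      ← Finsupp.single_sub, oscillator_fockVertexCoeff _ _ hk, add_sub_cancel_left,
      Finsupp.smul_single, sub_right_comm]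

theorem heisMode_lie_eMode (k n : ℤ) : ⁅heisMode k, eMode n⁆ = rootTwo • eMode (n + k) := by
  rw [eMode, heisMode_lie_vertexCoeff, eMode, Int.cast_one, one_mul]
  congr 2
  ring

theorem heisMode_lie_fMode (k n : ℤ) : ⁅heisMode k, fMode n⁆ = -rootTwo • fMode (n + k) := by
  rw [fMode, heisMode_lie_vertexCoeff, fMode]
  congr 2
  · push_cast
    ring
  · ring

theorem heisMode_lie_heisMode (n m : ℤ) :
    ⁅heisMode n, heisMode m⁆ = (if n + m = 0 then (n : ℂ) else 0) • 1 := by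
  refine latticeV_hom_ext fun j f => ?_
  rw [Ring.lie_def, LinearMap.sub_apply, Module.End.mul_apply, Module.End.mul_apply,
    LinearMap.smul_apply, Module.End.one_apply]
  rcases eq_or_ne n 0 with rfl | hn
  · rw [heisMode_zero_single, map_smul, heisMode_single, heisMode_zero_single, sub_self]
    simp
  rcases eq_or_ne m 0 with rfl | hm
  · rw [heisMode_zero_single, map_smul, heisMode_single, heisMode_zero_single, sub_self,
      if_neg (by omega), zero_smul]
  rw [heisMode_single_of_ne hn, heisMode_single_of_ne hm, heisMode_single_of_ne hn,
    heisMode_single_of_ne hm, oscillator_lie, ← Finsupp.single_sub, add_sub_cancel_left,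
    Finsupp.smul_single]

/-- A family of operators that is stable under commutators with the Heisenberg modes vanishes if it
kills the vacuum vectors. -/
theorem eq_zero_of_lie_heisMode {D : ℤ → ℤ → Module.End ℂ LatticeV} {c₁ c₂ : ℂ}
    (hD : ∀ k n m, ⁅heisMode k, D n m⁆ = c₁ • D (n + k) m + c₂ • D n (m + k))
    (hv : ∀ n m j, D n m (vac j) = 0) (n m : ℤ) : D n m = 0 := by
  refine latticeV_hom_ext fun j f => ?_
  rw [LinearMap.zero_apply]
  induction f using MvPolynomial.induction_on generalizing n m with
  | C a =>
    rw [← mul_one (MvPolynomial.C a), ← MvPolynomial.smul_eq_C_mul, ← Finsupp.smul_single, map_smul]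
    exact (congrArg _ (hv n m j)).trans (smul_zero a)
  | add p q hp hq => rw [Finsupp.single_add, map_add, hp, hq, add_zero]
  | mul_X p i hp =>
    -- Multiplication by xᵢ is a Heisenberg mode, and its commutator with a member of the family is
    -- a combination of members, all of which kill p by induction.
    have h := LinearMap.congr_fun (hD (-((i + 1 : ℕ) : ℤ)) n m) (Finsupp.single j p)
    rw [Ring.lie_def, LinearMap.sub_apply, Module.End.mul_apply, Module.End.mul_apply, hp,
      LinearMap.add_apply, LinearMap.smul_apply, LinearMap.smul_apply, hp, hp,
      heisMode_single_of_ne (by omega), oscillator_neg_succ, LinearMap.mulLeft_apply, mul_comm] at h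
    simpa using h

theorem eMode_lie_eMode (n m : ℤ) : ⁅eMode n, eMode m⁆ = 0 := by
  refine eq_zero_of_lie_heisMode (D := fun n m => ⁅eMode n, eMode m⁆) (c₁ := rootTwo)
    (c₂ := rootTwo) (fun k n m => ?_) (fun n m j => ?_) n m
  · rw [commutator_leibniz, heisMode_lie_eMode, heisMode_lie_eMode, smul_commutator,
      commutator_smul]
  · rw [vac, Ring.lie_def, LinearMap.sub_apply, Module.End.mul_apply, Module.End.mul_apply,
      eMode_single, eMode_single, eMode_single, eMode_single, fockVertexCoeff_one,
      fockVertexCoeff_one, fockVertexCoeff_vertexPoly_comm rootTwo_mul_self, sub_eq_zero]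
    congr 3 <;> ring

theorem fMode_lie_fMode (n m : ℤ) : ⁅fMode n, fMode m⁆ = 0 := by
  refine eq_zero_of_lie_heisMode (D := fun n m => ⁅fMode n, fMode m⁆) (c₁ := -rootTwo)
    (c₂ := -rootTwo) (fun k n m => ?_) (fun n m j => ?_) n m
  · rw [commutator_leibniz, heisMode_lie_fMode, heisMode_lie_fMode, smul_commutator,
      commutator_smul]
  · rw [vac, Ring.lie_def, LinearMap.sub_apply, Module.End.mul_apply, Module.End.mul_apply,
      fMode_single, fMode_single, fMode_single, fMode_single, fockVertexCoeff_one,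
      fockVertexCoeff_one,
      fockVertexCoeff_vertexPoly_comm (by rw [neg_mul_neg, rootTwo_mul_self]), sub_eq_zero]
    congr 3 <;> ring

theorem eMode_lie_fMode (n m : ℤ) : ⁅eMode n, fMode m⁆ =
    rootTwo • heisMode (n + m) + (if n + m = 0 then (n : ℂ) else 0) • 1 := by
  rw [← sub_eq_zero]
  refine eq_zero_of_lie_heisMode (D := fun n m => ⁅eMode n, fMode m⁆ -
    (rootTwo • heisMode (n + m) + (if n + m = 0 then (n : ℂ) else 0) • 1)) (c₁ := rootTwo)
    (c₂ := -rootTwo) (fun k n m => ?_) (fun n m j => ?_) n m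
  · rw [commutator_sub, commutator_add, commutator_smul, commutator_smul, commutator_one,
      commutator_leibniz, heisMode_lie_eMode,
      heisMode_lie_fMode, heisMode_lie_heisMode, smul_commutator, commutator_smul,
      add_right_comm n k m,
      ← add_assoc n m k, add_comm k, smul_zero]
    split_ifs with h
    -- The central terms of the two shifted relations have coefficients n + k and -n; their sum k is
    -- the central term of the Heisenberg bracket.
    · have hk : (k : ℂ) = ((n + k : ℤ) : ℂ) - (n : ℂ) := by push_cast; ring
      rw [hk]
      module
    · module
  · rw [vac, LinearMap.sub_apply, Ring.lie_def, LinearMap.sub_apply, Module.End.mul_apply,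
      Module.End.mul_apply, eMode_single, fMode_single, eMode_single, fMode_single,
      fockVertexCoeff_one, fockVertexCoeff_one, sub_add_cancel, add_sub_cancel_right,
      ← Finsupp.single_sub, LinearMap.add_apply, LinearMap.smul_apply, LinearMap.smul_apply,
      Module.End.one_apply, sub_eq_zero]
    have h := fockVertexCoeff_vertexPoly_sub rootTwo_mul_self (-n - 1 - 2 * (j - 1))
      (-m - 1 + 2 * j)
    rw [show -m - 1 + 2 * j + 2 = -m - 1 + 2 * (j + 1) by ring,
      show -n - 1 - 2 * (j - 1) - 2 = -n - 1 - 2 * j by ring,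
      show -n - 1 - 2 * (j - 1) + (-m - 1 + 2 * j) = -(n + m) by ring] at h
    rw [h]
    -- On the vacuum the three cases are a creation operator, the scalar n + 2j with 2j = √2 · j√2,
    -- and zero.
    rcases lt_trichotomy (n + m) 0 with h0 | h0 | h0
    · rw [heisMode_single_of_ne h0.ne, if_pos (by omega), if_neg (by omega), if_neg h0.ne]
      obtain ⟨i, hi⟩ : ∃ i : ℕ, n + m = -((i + 1 : ℕ) : ℤ) := ⟨(-(n + m) - 1).toNat, by omega⟩
      rw [hi, oscillator_neg_succ, LinearMap.mulLeft_apply, mul_one,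
        show (- -((i + 1 : ℕ) : ℤ) - 1).toNat = i by omega]
      simp
    · rw [h0, heisMode_zero_single, if_neg (by omega), if_pos (by omega), if_pos rfl, smul_smul,
        ← add_smul, smul_zero, zero_add, Finsupp.smul_single]
      congr 2
      push_cast
      linear_combination (-(j : ℂ)) * rootTwo_mul_self
    · rw [heisMode_single_of_ne h0.ne', if_neg (by omega), if_neg (by omega), if_neg h0.ne']
      obtain ⟨i, hi⟩ : ∃ i : ℕ, n + m = ((i + 1 : ℕ) : ℤ) := ⟨(n + m - 1).toNat, by omega⟩
      rw [hi, oscillator_natCast_succ_one]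
      simp

/-! ### The action of the affine Lie algebra -/

/-- The operator by which `x tⁿ` acts. -/
def loopOp (n : ℤ) : Sl2 →ₗ[ℂ] Module.End ℂ LatticeV where
  toFun x := x.1 0 1 • eMode n + x.1 1 0 • fMode n + (x.1 0 0 * rootTwo) • heisMode n
  map_add' x y := by
    have h : ∀ i j, (x + y).1 i j = x.1 i j + y.1 i j := fun _ _ => rfl
    rw [h, h, h]
    module
  map_smul' c x := by
    have h : ∀ i j, (c • x).1 i j = c * x.1 i j := fun _ _ => rfl
    rw [h, h, h, RingHom.id_apply]
    module

theorem sl2_apply_one_one (x : Sl2) : x.1 1 1 = -x.1 0 0 := by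
  have h : Matrix.trace x.1 = 0 := x.2
  rw [Matrix.trace_fin_two] at h
  exact eq_neg_of_add_eq_zero_right h

theorem loopOp_lie (n m : ℤ) (x y : Sl2) : ⁅loopOp n x, loopOp m y⁆ =
    loopOp (n + m) ⁅x, y⁆ + (if n + m = 0 then (n : ℂ) * sl2Form x y else 0) • 1 := by
  have hfe : ⁅fMode n, eMode m⁆ =
      -(rootTwo • heisMode (n + m) + (if n + m = 0 then (m : ℂ) else 0) • 1) := by
    rw [← neg_commutator, eMode_lie_fMode, add_comm m n]
  have heh : ⁅eMode n, heisMode m⁆ = -(rootTwo • eMode (n + m)) := by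
    rw [← neg_commutator, heisMode_lie_eMode]
  have hfh : ⁅fMode n, heisMode m⁆ = rootTwo • fMode (n + m) := by
    rw [← neg_commutator, heisMode_lie_fMode]
    module
  have hb : (⁅x, y⁆ : Sl2).1 = x.1 * y.1 - y.1 * x.1 := LieAlgebra.SpecialLinear.sl_bracket _ _ x y
  have hform : sl2Form x y = 2 * (x.1 0 0 * y.1 0 0) + x.1 0 1 * y.1 1 0 + x.1 1 0 * y.1 0 1 := by
    change Matrix.trace (x.1 * y.1) = _
    rw [Matrix.trace_fin_two, Matrix.mul_apply, Matrix.mul_apply, Fin.sum_univ_two,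
      Fin.sum_univ_two, sl2_apply_one_one, sl2_apply_one_one]
    ring
  change ⁅x.1 0 1 • eMode n + x.1 1 0 • fMode n + (x.1 0 0 * rootTwo) • heisMode n,
    y.1 0 1 • eMode m + y.1 1 0 • fMode m + (y.1 0 0 * rootTwo) • heisMode m⁆ =
    ((⁅x, y⁆ : Sl2).1 0 1 • eMode (n + m) + (⁅x, y⁆ : Sl2).1 1 0 • fMode (n + m) +
      ((⁅x, y⁆ : Sl2).1 0 0 * rootTwo) • heisMode (n + m)) + _
  simp only [commutator_add, add_commutator, commutator_smul, smul_commutator, eMode_lie_eMode,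
    fMode_lie_fMode,
    eMode_lie_fMode, heisMode_lie_eMode, heisMode_lie_fMode, heisMode_lie_heisMode, hfe, heh, hfh,
    hb, hform, Matrix.sub_apply, Matrix.mul_apply, Fin.sum_univ_two, sl2_apply_one_one,
    add_comm m n, smul_zero]
  refine LinearMap.ext fun v => ?_
  simp only [LinearMap.add_apply, LinearMap.smul_apply, LinearMap.neg_apply, LinearMap.zero_apply,
    Module.End.one_apply]
  generalize eMode (n + m) v = E, fMode (n + m) v = F
  split_ifs with h
  · have hm : (m : ℂ) = -n := by
      rw [eq_neg_iff_add_eq_zero, add_comm]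
      exact_mod_cast h
    rw [hm]
    -- Only √2 · √2 = 2 remains to be used: for the brackets of h with e, with f, and with h.
    linear_combination (norm := module) rootTwo_mul_self •
      ((x.1 0 0 * y.1 0 1 - x.1 0 1 * y.1 0 0) • E +
      (x.1 1 0 * y.1 0 0 - x.1 0 0 * y.1 1 0) • F + (n * (x.1 0 0 * y.1 0 0)) • v)
  · linear_combination (norm := module) rootTwo_mul_self •
      ((x.1 0 0 * y.1 0 1 - x.1 0 1 * y.1 0 0) • E +
      (x.1 1 0 * y.1 0 0 - x.1 0 0 * y.1 1 0) • F)

/-- The action of the loop algebra. -/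
def loopAction : LieAlgebra.loopAlgebra ℂ ℤ Sl2 →ₗ[ℂ] Module.End ℂ LatticeV :=
  Finsupp.lsum ℂ loopOp ∘ₗ (LieAlgebra.LoopAlgebra.toFinsupp ℂ ℤ Sl2).toLinearMap

theorem loopAction_single_tmul (n : ℤ) (x : Sl2) :
    loopAction (AddMonoidAlgebra.single n 1 ⊗ₜ[ℂ] x) = loopOp n x := by
  rw [loopAction, LinearMap.comp_apply, LinearEquiv.coe_coe,
    LieAlgebra.LoopAlgebra.toFinsupp_single_tmul, Finsupp.lsum_single]

theorem loopAlgebra_induction {P : LieAlgebra.loopAlgebra ℂ ℤ Sl2 → Prop}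
    (zero : P 0) (add : ∀ x y, P x → P y → P (x + y))
    (single : ∀ (n : ℤ) (x : Sl2), P (AddMonoidAlgebra.single n 1 ⊗ₜ[ℂ] x)) (x) : P x := by
  obtain ⟨f, rfl⟩ := (LieAlgebra.LoopAlgebra.toFinsupp ℂ ℤ Sl2).symm.surjective x
  induction f using Finsupp.induction_linear with
  | zero => rw [map_zero]; exact zero
  | add f g hf hg => rw [map_add]; exact add _ _ hf hg
  | single n x =>
    rw [LieAlgebra.LoopAlgebra.toFinsupp_symm_single]
    exact single n x

theorem loopAction_lie (x y : LieAlgebra.loopAlgebra ℂ ℤ Sl2) :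
    ⁅loopAction x, loopAction y⁆ = loopAction ⁅x, y⁆ +
      LieAlgebra.LoopAlgebra.residuePairing ℂ ℤ Sl2 (-sl2Form) x y • 1 := by
  induction x using loopAlgebra_induction with
  | zero =>
    have h : ⁅(0 : LieAlgebra.loopAlgebra ℂ ℤ Sl2), y⁆ = 0 := zero_lie y
    rw [h]
    simp [Ring.lie_def]
  | add x x' hx hx' =>
    have h : ⁅x + x', y⁆ = ⁅x, y⁆ + ⁅x', y⁆ := add_lie x x' y
    rw [map_add, add_commutator, hx, hx', h, map_add, map_add, LinearMap.add_apply, add_smul]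
    abel
  | single n x =>
    induction y using loopAlgebra_induction with
    | zero =>
      rw [show ∀ z : LieAlgebra.loopAlgebra ℂ ℤ Sl2, ⁅z, (0 : LieAlgebra.loopAlgebra ℂ ℤ Sl2)⁆ = 0
        from fun z => lie_zero z]
      simp [Ring.lie_def]
    | add y y' hy hy' =>
      rw [show ∀ z : LieAlgebra.loopAlgebra ℂ ℤ Sl2, ⁅z, y + y'⁆ = ⁅z, y⁆ + ⁅z, y'⁆
        from fun z => lie_add z y y', map_add, commutator_add, hy, hy', map_add, map_add, add_smul]
      abel
    | single m y =>
      rw [loopAction_single_tmul, loopAction_single_tmul, loopOp_lie,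
        LieAlgebra.ExtendScalars.bracket_tmul, AddMonoidAlgebra.single_mul_single, mul_one,
        loopAction_single_tmul]
      congr 2
      rw [LieAlgebra.LoopAlgebra.residuePairing_apply_apply,
        LieAlgebra.LoopAlgebra.toFinsupp_single_tmul, LieAlgebra.LoopAlgebra.toFinsupp_single_tmul,
        Finsupp.sum_single_index (by simp), Finsupp.single_apply]
      split_ifs with h1 h2 h2
      -- The residue pairing carries the factor m = -n, and the sign of `-sl2Form` restores n.
      · have hn : n = -m := by omega
        rw [hn]
        simp
      · omega
      · omega
      · simp

/-- The action of the affine Lie algebra. -/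
def affineAction : AffineSl2 →ₗ[ℂ] Module.End ℂ LatticeV where
  toFun x := loopAction ((LieAlgebra.ofProd affineCocycle).symm x).1 +
    (TrivialLieModule.equiv ℂ (LieAlgebra.loopAlgebra ℂ ℤ Sl2) ℂ
      ((LieAlgebra.ofProd affineCocycle).symm x).2) • 1
  map_add' x y := by
    rw [LieAlgebra.of_symm_add, Prod.fst_add, Prod.snd_add, map_add, map_add, add_smul]
    abel
  map_smul' c x := by
    rw [LieAlgebra.of_symm_smul, Prod.smul_fst, Prod.smul_snd, map_smul, map_smul, smul_add,
      smul_assoc, RingHom.id_apply]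

theorem affineAction_ofProd (a : LieAlgebra.loopAlgebra ℂ ℤ Sl2)
    (b : TrivialLieModule ℂ (LieAlgebra.loopAlgebra ℂ ℤ Sl2) ℂ) :
    affineAction (LieAlgebra.ofProd affineCocycle (a, b)) = loopAction a +
      (TrivialLieModule.equiv ℂ (LieAlgebra.loopAlgebra ℂ ℤ Sl2) ℂ b) • 1 := rfl

theorem lie_ofProd (a a' : LieAlgebra.loopAlgebra ℂ ℤ Sl2)
    (b b' : TrivialLieModule ℂ (LieAlgebra.loopAlgebra ℂ ℤ Sl2) ℂ) :
    ⁅LieAlgebra.ofProd affineCocycle (a, b), LieAlgebra.ofProd affineCocycle (a', b')⁆ =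
      LieAlgebra.ofProd affineCocycle (⁅a, a'⁆,
        (TrivialLieModule.equiv ℂ (LieAlgebra.loopAlgebra ℂ ℤ Sl2) ℂ).symm
          (LieAlgebra.LoopAlgebra.residuePairing ℂ ℤ Sl2 (-sl2Form) a a')) := by
  have lie_triv : ∀ (a : LieAlgebra.loopAlgebra ℂ ℤ Sl2)
      (b : TrivialLieModule ℂ (LieAlgebra.loopAlgebra ℂ ℤ Sl2) ℂ), ⁅a, b⁆ = 0 :=
    fun a b => trivial_lie_zero _ _ a b
  rw [LieAlgebra.bracket_ofTwoCocycle, lie_triv, lie_triv, add_zero, sub_zero]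
  rfl

theorem affineAction_lie (x y : AffineSl2) :
    affineAction ⁅x, y⁆ = ⁅affineAction x, affineAction y⁆ := by
  have one_comm : ∀ T : Module.End ℂ LatticeV, ⁅(1 : Module.End ℂ LatticeV), T⁆ = 0 := fun T => by
    simp [Ring.lie_def]
  obtain ⟨⟨a, b⟩, rfl⟩ := (LieAlgebra.ofProd affineCocycle).surjective x
  obtain ⟨⟨a', b'⟩, rfl⟩ := (LieAlgebra.ofProd affineCocycle).surjective y
  rw [lie_ofProd, affineAction_ofProd, affineAction_ofProd, affineAction_ofProd, commutator_add,
    add_commutator, add_commutator, commutator_smul, commutator_smul, smul_commutator,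
    smul_commutator, commutator_one, commutator_one, one_comm, smul_zero, smul_zero, add_zero,
    add_zero,
    add_zero, loopAction_lie, LinearEquiv.apply_symm_apply]

/-- The action of the affine Lie algebra makes the lattice vertex algebra a Lie module. -/
abbrev affineLieRingModule : LieRingModule AffineSl2 LatticeV where
  bracket x v := affineAction x v
  add_lie x y v := by
    change affineAction (x + y) v = affineAction x v + affineAction y v
    rw [map_add, LinearMap.add_apply]
  lie_add x v w := map_add (affineAction x) v w
  leibniz_lie x y v := by
    change affineAction x (affineAction y v) = affineAction ⁅x, y⁆ v +
      affineAction y (affineAction x v)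
    rw [affineAction_lie, Ring.lie_def]
    exact (sub_add_cancel (affineAction x (affineAction y v)) _).symm

theorem affineLieModule :
    letI := affineLieRingModule
    LieModule ℂ AffineSl2 LatticeV :=
  letI := affineLieRingModule
  { smul_lie := fun c x v => by
      change affineAction (c • x) v = c • affineAction x v
      rw [map_smul, LinearMap.smul_apply]
    lie_smul := fun c x v => map_smul (affineAction x) c v }

theorem affineAction_loopElt (x : Sl2) (n : ℤ) : affineAction (loopElt x n) = loopOp n x := by
  change loopAction (AddMonoidAlgebra.single n 1 ⊗ₜ[ℂ] x) +
    (TrivialLieModule.equiv ℂ (LieAlgebra.loopAlgebra ℂ ℤ Sl2) ℂ 0) • 1 = _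
  rw [map_zero, zero_smul, add_zero, loopAction_single_tmul]

theorem affineAction_centralK : affineAction centralK = 1 := by
  change loopAction 0 + (TrivialLieModule.equiv ℂ (LieAlgebra.loopAlgebra ℂ ℤ Sl2) ℂ
    ((TrivialLieModule.equiv ℂ (LieAlgebra.loopAlgebra ℂ ℤ Sl2) ℂ).symm 1)) • 1 = _
  rw [map_zero, zero_add, LinearEquiv.apply_symm_apply, one_smul]

theorem affineAction_loopElt_sl2E (n : ℤ) : affineAction (loopElt sl2E n) = eMode n := by
  rw [affineAction_loopElt]
  change (1 : ℂ) • eMode n + (0 : ℂ) • fMode n + ((0 : ℂ) * rootTwo) • heisMode n = _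
  module

theorem affineAction_loopElt_sl2F (n : ℤ) : affineAction (loopElt sl2F n) = fMode n := by
  rw [affineAction_loopElt]
  change (0 : ℂ) • eMode n + (1 : ℂ) • fMode n + ((0 : ℂ) * rootTwo) • heisMode n = _
  module

theorem affineAction_loopElt_sl2H (n : ℤ) :
    affineAction (loopElt sl2H n) = rootTwo • heisMode n := by
  rw [affineAction_loopElt]
  change (0 : ℂ) • eMode n + (0 : ℂ) • fMode n + ((1 : ℂ) * rootTwo) • heisMode n = _
  module

/-! ### Irreducibility -/

theorem heisMode_zero_apply (v : LatticeV) (j : ℤ) :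
    heisMode 0 v j = ((j : ℂ) * rootTwo) • v j := by
  induction v using Finsupp.induction_linear with
  | zero => rw [map_zero, Finsupp.zero_apply, smul_zero]
  | add v w hv hw => rw [map_add, Finsupp.add_apply, hv, hw, Finsupp.add_apply, smul_add]
  | single i f =>
    rw [heisMode_zero_single, Finsupp.smul_apply, Finsupp.single_apply]
    split_ifs with h
    · rw [h]
    · rw [smul_zero, smul_zero]

/-- This mode picks out the degree 0 term of the creation part. It underlies the identification of a
vacuum with an infinite product and the nesting of the basic subspaces. -/
theorem eMode_vac (j : ℤ) : eMode (-1 - 2 * j) (vac j) = vac (j + 1) := by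
  rw [vac, eMode_single, fockVertexCoeff_one, show -(-1 - 2 * j) - 1 - 2 * j = 0 by ring,
    vertexPoly_zero, vac]

theorem fMode_vac (j : ℤ) : fMode (2 * j - 1) (vac j) = vac (j - 1) := by
  rw [vac, fMode_single, fockVertexCoeff_one, show -(2 * j - 1) - 1 + 2 * j = 0 by ring,
    vertexPoly_zero, vac]

section Stable

variable {N : Submodule ℂ LatticeV}

/-- Applying a_0 - i√2 removes the component at i and rescales the others by nonzero numbers;
repeating this isolates one component. -/
theorem exists_single_mem_of_heisMode_mem (ha : ∀ n, ∀ v ∈ N, heisMode n v ∈ N) (k : ℕ) :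
    ∀ v ∈ N, v ≠ 0 → v.support.card ≤ k → ∃ j f, f ≠ 0 ∧ Finsupp.single j f ∈ N := by
  induction k with
  | zero =>
    intro v _ h0 hk
    exact absurd (Finsupp.support_eq_empty.1 (Finset.card_eq_zero.1 (Nat.le_zero.1 hk))) h0
  | succ k ih =>
    intro v hv h0 hk
    obtain ⟨i, hi⟩ := Finsupp.support_nonempty_iff.2 h0
    have hw : ∀ j, (heisMode 0 v - ((i : ℂ) * rootTwo) • v) j =
        (((j : ℂ) - i) * rootTwo) • v j := fun j => by
      rw [Finsupp.sub_apply, heisMode_zero_apply, Finsupp.smul_apply, ← sub_smul, ← sub_mul]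
    rcases eq_or_ne (heisMode 0 v - ((i : ℂ) * rootTwo) • v) 0 with h | h
    · refine ⟨i, v i, Finsupp.mem_support_iff.1 hi, ?_⟩
      convert hv
      ext1 j
      rcases eq_or_ne i j with rfl | hij
      · rw [Finsupp.single_eq_same]
      · have h1 := hw j
        rw [h, Finsupp.zero_apply, eq_comm, smul_eq_zero] at h1
        rw [Finsupp.single_eq_of_ne hij.symm, h1.resolve_left]
        refine mul_ne_zero (sub_ne_zero.2 ?_) rootTwo_ne_zero
        exact_mod_cast hij.symm
    · refine ih _ (N.sub_mem (ha 0 v hv) (N.smul_mem _ hv)) h ?_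
      refine Nat.lt_succ_iff.1 (lt_of_lt_of_le (Finset.card_lt_card ?_) hk)
      refine (Finset.ssubset_iff_of_subset fun j hj => ?_).2 ⟨i, hi, ?_⟩
      · rw [Finsupp.mem_support_iff, hw] at hj
        exact Finsupp.mem_support_iff.2 fun h => hj (by rw [h, smul_zero])
      · rw [Finsupp.mem_support_iff, hw]
        simp

/-- A positive oscillator lowers the weight bound; when all of them kill f, it is a nonzero
constant. -/
theorem vac_mem_of_heisMode_mem (ha : ∀ n, ∀ v ∈ N, heisMode n v ∈ N) (j : ℤ) (d : ℕ) :
    ∀ f ∈ weightLT d, f ≠ 0 → Finsupp.single j f ∈ N → vac j ∈ N := by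
  induction d with
  | zero =>
    intro f hf h0
    rw [weightLT_zero, Submodule.mem_bot] at hf
    exact absurd hf h0
  | succ d ih =>
    intro f hf h0 hN
    by_cases h : ∀ i : ℕ, oscillator ((i + 1 : ℕ) : ℤ) f = 0
    · have hc : f = MvPolynomial.C (MvPolynomial.constantCoeff f) := by
        refine eq_of_oscillator_eq (fun i => ?_) (by simp)
        rw [h, ← mul_one (MvPolynomial.C _), ← MvPolynomial.smul_eq_C_mul, map_smul,
          oscillator_natCast_succ_one, smul_zero]
      have hc0 : MvPolynomial.constantCoeff f ≠ 0 := fun h1 => h0 (by rw [hc, h1, map_zero])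
      have h2 := N.smul_mem (MvPolynomial.constantCoeff f)⁻¹ hN
      rw [hc, Finsupp.smul_single, MvPolynomial.constantCoeff_C, MvPolynomial.smul_eq_C_mul,
        ← map_mul, inv_mul_cancel₀ hc0, map_one] at h2
      exact h2
    · push Not at h
      obtain ⟨i, hi⟩ := h
      refine ih _ ?_ hi ?_
      · have h3 := oscillator_mem_weightLT (i + 1) _ _ hf
        have hle : d + 1 - (i + 1) ≤ d := by omega
        exact MvPolynomial.restrictSupport_mono ℂ (fun s hs => lt_of_lt_of_le hs hle) h3
      · rw [← heisMode_single_of_ne (n := ((i + 1 : ℕ) : ℤ)) (by omega)]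
        exact ha _ _ hN

theorem single_mem_of_vac_mem (ha : ∀ n, ∀ v ∈ N, heisMode n v ∈ N) {j : ℤ} (h : vac j ∈ N)
    (f : Fock) : Finsupp.single j f ∈ N := by
  induction f using MvPolynomial.induction_on with
  | C a =>
    rw [← mul_one (MvPolynomial.C a), ← MvPolynomial.smul_eq_C_mul, ← Finsupp.smul_single]
    exact N.smul_mem a h
  | add p q hp hq => rw [Finsupp.single_add]; exact N.add_mem hp hq
  | mul_X p i hp =>
    have h1 := ha (-((i + 1 : ℕ) : ℤ)) _ hp
    rwa [heisMode_single_of_ne (by omega), oscillator_neg_succ, LinearMap.mulLeft_apply,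
      mul_comm] at h1

theorem eq_top_of_modes_mem (hN : N ≠ ⊥) (ha : ∀ n, ∀ v ∈ N, heisMode n v ∈ N)
    (he : ∀ n, ∀ v ∈ N, eMode n v ∈ N) (hf : ∀ n, ∀ v ∈ N, fMode n v ∈ N) : N = ⊤ := by
  obtain ⟨v, hv, h0⟩ := (Submodule.ne_bot_iff _).1 hN
  obtain ⟨j, f, hf0, hfN⟩ := exists_single_mem_of_heisMode_mem ha _ v hv h0 le_rfl
  obtain ⟨d, hd⟩ := exists_mem_weightLT f
  have hj := vac_mem_of_heisMode_mem ha j d f hd hf0 hfN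
  have hall : ∀ i : ℤ, vac i ∈ N := by
    intro i
    induction i using Int.inductionOn' (b := j) with
    | zero => exact hj
    | succ k _ hk => rw [← eMode_vac]; exact he _ _ hk
    | pred k _ hk => rw [← fMode_vac]; exact hf _ _ hk
  refine eq_top_iff.2 fun w _ => ?_
  induction w using Finsupp.induction_linear with
  | zero => exact N.zero_mem
  | add w w' hw hw' => exact N.add_mem (hw trivial) (hw' trivial)
  | single i g => exact single_mem_of_vac_mem ha (hall i) g

end Stable

theorem isHighestWeightModule_latticeV :
    letI := affineLieRingModule
    haveI := affineLieModule
    IsHighestWeightModule 0 1 LatticeV := by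
  let := affineLieRingModule
  have := affineLieModule
  have hirr : LieModule.IsIrreducible ℂ AffineSl2 LatticeV := by
    refine LieModule.IsIrreducible.mk fun N hN => ?_
    rw [← LieSubmodule.toSubmodule_eq_top]
    have key : ∀ (x : AffineSl2), ∀ v ∈ N.toSubmodule, affineAction x v ∈ N.toSubmodule :=
      fun x v hv => N.lie_mem hv
    refine eq_top_of_modes_mem (fun h => hN (LieSubmodule.toSubmodule_eq_bot _ |>.1 h))
      (fun n v hv => ?_) (fun n v hv => ?_) (fun n v hv => ?_)
    · have h := N.toSubmodule.smul_mem rootTwo⁻¹ (key (loopElt sl2H n) v hv)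
      rwa [affineAction_loopElt_sl2H, LinearMap.smul_apply, inv_smul_smul₀ rootTwo_ne_zero] at h
    · rw [← affineAction_loopElt_sl2E]
      exact key _ v hv
    · rw [← affineAction_loopElt_sl2F]
      exact key _ v hv
  have hvac : vac 0 ≠ 0 := by
    rw [vac, Ne, Finsupp.single_eq_zero]
    exact one_ne_zero
  have hE : ∀ n : ℤ, 0 ≤ n → eMode n (vac 0) = 0 := fun n hn => by
    rw [vac, eMode_single, fockVertexCoeff_one, vertexPoly_of_neg _ (by omega),
      Finsupp.single_zero]
  have hF : ∀ n : ℤ, 0 ≤ n → fMode n (vac 0) = 0 := fun n hn => by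
    rw [vac, fMode_single, fockVertexCoeff_one, vertexPoly_of_neg _ (by omega),
      Finsupp.single_zero]
  have hH : ∀ n : ℤ, 0 ≤ n → heisMode n (vac 0) = 0 := fun n hn => by
    rcases hn.eq_or_lt with rfl | h
    · rw [vac, heisMode_zero_single, Int.cast_zero, zero_mul, zero_smul]
    · obtain ⟨i, rfl⟩ : ∃ i : ℕ, n = ((i + 1 : ℕ) : ℤ) := ⟨(n - 1).toNat, by omega⟩
      rw [vac, heisMode_single_of_ne (by omega), oscillator_natCast_succ_one, Finsupp.single_zero]
  refine ⟨hirr, vac 0, ?_, ?_, fun n hn x => ?_, ?_, ?_⟩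
  -- In an irreducible module every nonzero vector is cyclic.
  · refine (eq_bot_or_eq_top _).resolve_left fun h => hvac ?_
    have h1 := LieSubmodule.subset_lieSpan (R := ℂ) (L := AffineSl2) (s := {vac 0})
      (Set.mem_singleton (vac 0))
    rw [h] at h1
    exact h1
  · change affineAction (loopElt sl2E 0) (vac 0) = 0
    rw [affineAction_loopElt_sl2E, hE 0 le_rfl]
  · change affineAction (loopElt x n) (vac 0) = 0
    rw [affineAction_loopElt]
    change x.1 0 1 • eMode n (vac 0) + x.1 1 0 • fMode n (vac 0) +
      (x.1 0 0 * rootTwo) • heisMode n (vac 0) = 0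
    rw [hE n hn.le, hF n hn.le, hH n hn.le, smul_zero, smul_zero, smul_zero, add_zero, add_zero]
  · change affineAction (loopElt sl2H 0) (vac 0) = _
    rw [affineAction_loopElt_sl2H, LinearMap.smul_apply, hH 0 le_rfl, smul_zero, zero_smul]
  · change affineAction centralK (vac 0) = _
    rw [affineAction_centralK, one_smul, Module.End.one_apply]

/-! ### Triangular endomorphisms of the polynomial ring -/

/-- The colexicographic order on exponent vectors. -/
def ColexLT (s t : ℕ →₀ ℕ) : Prop := ∃ m, s m < t m ∧ ∀ i, m < i → s i = t i

instance : IsStrictOrder (ℕ →₀ ℕ) ColexLT where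
  irrefl s := fun ⟨_, hm, _⟩ => lt_irrefl _ hm
  trans s t u := by
    rintro ⟨m, hm, hm'⟩ ⟨n, hn, hn'⟩
    rcases lt_trichotomy m n with h | rfl | h
    · exact ⟨n, by rw [hm' n h]; exact hn, fun i hi => by rw [hm' i (h.trans hi), hn' i hi]⟩
    · exact ⟨m, hm.trans hn, fun i hi => by rw [hm' i hi, hn' i hi]⟩
    · exact ⟨m, by rw [← hn' m h]; exact hm, fun i hi => by rw [hm' i hi, hn' i (h.trans hi)]⟩

theorem ColexLT.add_left {s t : ℕ →₀ ℕ} (h : ColexLT s t) (u : ℕ →₀ ℕ) :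
    ColexLT (u + s) (u + t) := by
  obtain ⟨m, hm, hm'⟩ := h
  exact ⟨m, by simpa using hm, fun i hi => by simp [hm' i hi]⟩

/-- A variable beyond all those of s makes t larger, whatever the other exponents are. -/
theorem colexLT_of_apply_ne_zero {s t : ℕ →₀ ℕ} {k : ℕ} (hs : ∀ i, k ≤ i → s i = 0)
    (ht : t k ≠ 0) : ColexLT s t := by
  have hne : t.support.Nonempty := ⟨k, Finsupp.mem_support_iff.2 ht⟩
  have hk : k ≤ t.support.max' hne := Finset.le_max' _ _ (Finsupp.mem_support_iff.2 ht)
  refine ⟨t.support.max' hne, ?_, fun i hi => ?_⟩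
  · rw [hs _ hk]
    exact Nat.pos_of_ne_zero (Finsupp.mem_support_iff.1 (Finset.max'_mem _ hne))
  · rw [hs i (hk.trans hi.le), eq_comm, ← Finsupp.notMem_support_iff]
    exact fun h => absurd (Finset.le_max' _ _ h) (not_le.2 hi)

theorem monoWeight_add (s t : ℕ →₀ ℕ) : monoWeight (s + t) = monoWeight s + monoWeight t :=
  Finsupp.sum_add_index' (by simp) (by intros; ring)

theorem monoWeight_single (i c : ℕ) : monoWeight (Finsupp.single i c) = c * (i + 1) :=
  Finsupp.sum_single_index (by simp)

theorem finite_monoWeight_eq (n : ℕ) : {s : ℕ →₀ ℕ | monoWeight s = n}.Finite := by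
  refine (Set.finite_Iic (∑ i ∈ Finset.range n, Finsupp.single i n)).subset fun s hs i => ?_
  have h : s i * (i + 1) ≤ n := by
    rw [← show monoWeight s = n from hs]
    by_cases hi : i ∈ s.support
    · exact Finset.single_le_sum (f := fun i => s i * (i + 1)) (fun _ _ => Nat.zero_le _) hi
    · rw [Finsupp.notMem_support_iff.1 hi]
      simp
  rw [Finsupp.finsetSum_apply]
  rcases Nat.eq_zero_or_pos (s i) with h0 | h0
  · rw [h0]
    exact Nat.zero_le _
  · have hi : i < n := by nlinarith
    refine le_trans ?_ (Finset.single_le_sum (f := fun j => (Finsupp.single j n : ℕ →₀ ℕ) i)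
      (fun _ _ => Nat.zero_le _) (Finset.mem_range.2 hi))
    rw [Finsupp.single_eq_same]
    nlinarith

theorem coeff_eq_zero_of_mem_restrictSupport {S : Set (ℕ →₀ ℕ)} {f : Fock}
    (hf : f ∈ MvPolynomial.restrictSupport ℂ S) {s : ℕ →₀ ℕ} (hs : s ∉ S) :
    MvPolynomial.coeff s f = 0 := by
  rw [MvPolynomial.mem_restrictSupport_iff] at hf
  exact MvPolynomial.notMem_support_iff.1 fun h => hs (hf h)

/-- Injectivity: the colex-smallest monomial of f keeps its coefficient in T f, since all
corrections go up. Surjectivity: each weight has finitely many monomials, so the corrections can be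
removed by descending from the largest. -/
theorem bijective_of_triangular (T : Module.End ℂ Fock)
    (hT : ∀ s, T (MvPolynomial.monomial s 1) - MvPolynomial.monomial s 1 ∈
      MvPolynomial.restrictSupport ℂ {t | ColexLT s t ∧ monoWeight t = monoWeight s}) :
    Function.Bijective T := by
  constructor
  · rw [← LinearMap.ker_eq_bot, LinearMap.ker_eq_bot']
    intro f hf
    by_contra h0
    have hne : f.support.Nonempty := by
      rw [Finset.nonempty_iff_ne_empty, Ne, MvPolynomial.support_eq_empty]
      exact h0
    have hwf : (f.support : Set (ℕ →₀ ℕ)).WellFoundedOn ColexLT :=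
      (Finset.finite_toSet _).wellFoundedOn
    obtain ⟨⟨s, hs⟩, -, hmin⟩ := WellFounded.has_min hwf Set.univ
      ⟨⟨hne.choose, hne.choose_spec⟩, trivial⟩
    have key : MvPolynomial.coeff s (T f) = MvPolynomial.coeff s f := by
      conv_lhs => rw [MvPolynomial.as_sum f, map_sum, MvPolynomial.coeff_sum]
      rw [Finset.sum_eq_single s]
      · have h1 := coeff_eq_zero_of_mem_restrictSupport (hT s) (s := s)
          (fun h => irrefl_of ColexLT s h.1)
        rw [MvPolynomial.coeff_sub, MvPolynomial.coeff_monomial, if_pos rfl, sub_eq_zero] at h1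
        rw [← mul_one (MvPolynomial.coeff s f), ← smul_eq_mul, ← MvPolynomial.smul_monomial,
          map_smul, MvPolynomial.coeff_smul, h1]
      · intro t ht hts
        have h1 := coeff_eq_zero_of_mem_restrictSupport (hT t) (s := s)
          (fun h => hmin ⟨t, ht⟩ trivial h.1)
        rw [MvPolynomial.coeff_sub, MvPolynomial.coeff_monomial, if_neg hts, sub_zero] at h1
        rw [← mul_one (MvPolynomial.coeff t f), ← smul_eq_mul, ← MvPolynomial.smul_monomial,
          map_smul, MvPolynomial.coeff_smul, h1, smul_zero]
      · exact fun h => absurd hs h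
    rw [hf, MvPolynomial.coeff_zero] at key
    exact MvPolynomial.mem_support_iff.1 hs key.symm
  · have hmem : ∀ n, ∀ s ∈ {s : ℕ →₀ ℕ | monoWeight s = n},
        MvPolynomial.monomial s (1 : ℂ) ∈ LinearMap.range T := by
      intro n s hs
      have hwf : {s : ℕ →₀ ℕ | monoWeight s = n}.WellFoundedOn (Function.swap ColexLT) :=
        (finite_monoWeight_eq n).wellFoundedOn
      refine hwf.induction hs (P := fun s => MvPolynomial.monomial s (1 : ℂ) ∈ LinearMap.range T)
        fun s hs ih => ?_
      have h1 : MvPolynomial.restrictSupport ℂ {t | ColexLT s t ∧ monoWeight t = monoWeight s} ≤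
          LinearMap.range T := by
        rw [MvPolynomial.restrictSupport_eq_span, Submodule.span_le]
        rintro _ ⟨t, ⟨ht, hw⟩, rfl⟩
        exact ih t (hw.trans hs) ht
      have h2 := Submodule.sub_mem _ (LinearMap.mem_range_self T (MvPolynomial.monomial s 1))
        (h1 (hT s))
      rwa [sub_sub_cancel] at h2
    intro f
    rw [← LinearMap.mem_range, MvPolynomial.as_sum f]
    refine Submodule.sum_mem _ fun s _ => ?_
    rw [← mul_one (MvPolynomial.coeff s f), ← smul_eq_mul, ← MvPolynomial.smul_monomial]
    exact Submodule.smul_mem _ _ (hmem _ s rfl)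

/-! ### The polynomial generators given by the creation part -/

/-- The substitution of the coefficients of `exp (√2 ∑ xₙ₋₁ zⁿ / n)` for the variables. -/
def vertexHom : Fock →ₐ[ℂ] Fock :=
  MvPolynomial.aeval fun i => vertexPoly rootTwo ((i + 1 : ℕ) : ℤ)

theorem vertexHom_X (i : ℕ) : vertexHom (MvPolynomial.X i) =
    vertexPoly rootTwo ((i + 1 : ℕ) : ℤ) := by
  rw [vertexHom, MvPolynomial.aeval_X]

/-- Newton's identity with its last term split off: xᵢ occurs with an invertible coefficient and the
other terms involve smaller indices, so it can be solved either way. -/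
theorem newton_rootTwo (i : ℕ) : ((i : ℂ) + 1) • vertexPoly rootTwo ((i + 1 : ℕ) : ℤ) =
    rootTwo • (∑ k : Fin i, MvPolynomial.X (k : ℕ) * vertexPoly rootTwo ((i - k : ℕ) : ℤ) +
      MvPolynomial.X i) := by
  have h := smul_vertexPoly rootTwo (i + 1) (n := ((i + 1 : ℕ) : ℤ)) le_rfl
  rw [Finset.sum_range_succ, show ((i + 1 : ℕ) : ℤ) - 1 - i = 0 by push_cast; ring,
    vertexPoly_zero, mul_one] at h
  push_cast at h ⊢
  rw [h, ← Finset.sum_range fun k =>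
    (MvPolynomial.X k * vertexPoly rootTwo ((i - k : ℕ) : ℤ) : Fock)]
  congr 2
  refine Finset.sum_congr rfl fun k hk => ?_
  rw [Finset.mem_range] at hk
  rw [show (i : ℤ) + 1 - 1 - k = ((i - k : ℕ) : ℤ) by omega]

/-- The variables, expressed through the coefficients of `exp (√2 ∑ xₙ₋₁ zⁿ / n)`. -/
def newtonPoly (i : ℕ) : Fock :=
  -- The variable of index m stands for `vertexPoly rootTwo (m + 1)`, whence i - k - 1 for the
  -- coefficient of index i - k.
  (((i : ℂ) + 1) / rootTwo) • MvPolynomial.X i -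
    ∑ k : Fin i, newtonPoly k * MvPolynomial.X (i - k - 1)
termination_by i
decreasing_by exact k.2

/-- The inverse of `vertexHom`. -/
def vertexInv : Fock →ₐ[ℂ] Fock := MvPolynomial.aeval newtonPoly

theorem vertexInv_vertexPoly (i : ℕ) :
    vertexInv (vertexPoly rootTwo ((i + 1 : ℕ) : ℤ)) = MvPolynomial.X i := by
  induction i using Nat.strong_induction_on with
  | _ i ih =>
    have h0 : (i : ℂ) + 1 ≠ 0 := Nat.cast_add_one_ne_zero i
    have h := congrArg vertexInv (newton_rootTwo i)
    have hX : ∀ k, vertexInv (MvPolynomial.X k) = newtonPoly k := fun k => by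
      rw [vertexInv, MvPolynomial.aeval_X]
    rw [map_smul, map_smul, map_add, map_sum, hX] at h
    have h1 : ∀ k : Fin i, vertexInv
        (MvPolynomial.X (k : ℕ) * vertexPoly rootTwo ((i - k : ℕ) : ℤ)) =
        newtonPoly k * MvPolynomial.X (i - k - 1) := fun k => by
      have hk := k.2
      rw [map_mul, hX, ← ih (i - k - 1) (by omega), show i - k - 1 + 1 = i - (k : ℕ) by omega]
    rw [Finset.sum_congr rfl fun k _ => h1 k, newtonPoly, add_sub_cancel, smul_smul,
      mul_div_cancel₀ _ rootTwo_ne_zero] at h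
    exact smul_right_injective _ h0 h

theorem vertexInv_vertexHom (f : Fock) : vertexInv (vertexHom f) = f := by
  have h : vertexInv.comp vertexHom = AlgHom.id ℂ Fock := by
    ext1 i
    rw [AlgHom.comp_apply, vertexHom_X, vertexInv_vertexPoly, AlgHom.id_apply]
  exact DFunLike.congr_fun h f

theorem vertexHom_bijective : Function.Bijective vertexHom := by
  refine ⟨Function.LeftInverse.injective vertexInv_vertexHom, ?_⟩
  rw [← AlgHom.range_eq_top, eq_top_iff, ← MvPolynomial.adjoin_range_X, Algebra.adjoin_le_iff]
  rintro _ ⟨i, rfl⟩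
  have hmem : ∀ m : ℕ, vertexPoly rootTwo ((m + 1 : ℕ) : ℤ) ∈ vertexHom.range :=
    fun m => ⟨MvPolynomial.X m, vertexHom_X m⟩
  induction i using Nat.strong_induction_on with
  | _ i ih =>
    have h := newton_rootTwo i
    have h1 : (MvPolynomial.X i : Fock) = (rootTwo⁻¹ * ((i : ℂ) + 1)) •
        vertexPoly rootTwo ((i + 1 : ℕ) : ℤ) -
        ∑ k : Fin i, MvPolynomial.X (k : ℕ) * vertexPoly rootTwo ((i - k : ℕ) : ℤ) := by
      rw [mul_smul, h, inv_smul_smul₀ rootTwo_ne_zero, add_sub_cancel_left]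
    rw [SetLike.mem_coe, h1]
    refine Subalgebra.sub_mem _ (Subalgebra.smul_mem _ (hmem i) _)
      (Subalgebra.sum_mem _ fun k _ => Subalgebra.mul_mem _ (ih k k.2) ?_)
    have hk := k.2
    have h2 := hmem (i - k - 1)
    rwa [show i - k - 1 + 1 = i - (k : ℕ) by omega] at h2

/-- The linear combinations of the monomials with exponents in `S` in the coefficients of
`exp (√2 ∑ xₙ₋₁ zⁿ / n)`. -/
def vertexSupport (S : Set (ℕ →₀ ℕ)) : Submodule ℂ Fock :=
  (MvPolynomial.restrictSupport ℂ S).map vertexHom.toLinearMap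

theorem vertexSupport_mono {S S' : Set (ℕ →₀ ℕ)} (h : S ⊆ S') :
    vertexSupport S ≤ vertexSupport S' :=
  Submodule.map_mono (MvPolynomial.restrictSupport_mono ℂ h)

theorem vertexHom_monomial_mem {S : Set (ℕ →₀ ℕ)} {s : ℕ →₀ ℕ} (h : s ∈ S) :
    vertexHom (MvPolynomial.monomial s 1) ∈ vertexSupport S :=
  ⟨_, (MvPolynomial.monomial_mem_restrictSupport ℂ).2 (Or.inl h), rfl⟩

theorem mul_mem_vertexSupport {S S' U : Set (ℕ →₀ ℕ)} (h : ∀ s ∈ S, ∀ t ∈ S', s + t ∈ U)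
    {f g : Fock} (hf : f ∈ vertexSupport S) (hg : g ∈ vertexSupport S') :
    f * g ∈ vertexSupport U := by
  obtain ⟨f, hf, rfl⟩ := hf
  obtain ⟨g, hg, rfl⟩ := hg
  refine ⟨f * g, ?_, map_mul vertexHom f g⟩
  rw [SetLike.mem_coe, MvPolynomial.mem_restrictSupport_iff] at *
  intro u hu
  obtain ⟨s, hs, t, ht, rfl⟩ := Finset.mem_add.1 (MvPolynomial.support_mul f g hu)
  exact h s (hf hs) t (hg ht)

theorem vertexPoly_succ_mem {S : Set (ℕ →₀ ℕ)} {i : ℕ} (h : Finsupp.single i 1 ∈ S) :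
    vertexPoly rootTwo ((i + 1 : ℕ) : ℤ) ∈ vertexSupport S := by
  rw [← vertexHom_X]
  exact vertexHom_monomial_mem h

theorem vertexPoly_mem (n : ℤ) :
    vertexPoly rootTwo n ∈ vertexSupport {t | (monoWeight t : ℤ) = n} := by
  rcases lt_trichotomy n 0 with h | rfl | h
  · rw [vertexPoly_of_neg _ h]
    exact Submodule.zero_mem _
  · rw [vertexPoly_zero, ← map_one vertexHom]
    exact vertexHom_monomial_mem (by simp [monoWeight])
  · obtain ⟨i, rfl⟩ : ∃ i : ℕ, n = ((i + 1 : ℕ) : ℤ) := ⟨(n - 1).toNat, by omega⟩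
    refine vertexPoly_succ_mem ?_
    rw [Set.mem_ofPred_eq, monoWeight_single, one_mul]

/-- On a single generator this is `annihilCoeff_vertexPoly`; multiplicativity of `shiftHom` extends
it to products. The annihilation part thus lowers the weight in the new generators. -/
theorem coeff_shiftHom_vertexHom_monomial_mem (s : ℕ →₀ ℕ) :
    ∀ l : ℕ, PowerSeries.coeff l (shiftHom rootTwo (vertexHom (MvPolynomial.monomial s 1))) ∈
      vertexSupport {t | monoWeight t + l = monoWeight s} := by
  have hmul : ∀ (n m : ℕ) (F G : PowerSeries Fock),
      (∀ l, PowerSeries.coeff l F ∈ vertexSupport {t | monoWeight t + l = n}) →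
      (∀ l, PowerSeries.coeff l G ∈ vertexSupport {t | monoWeight t + l = m}) →
      ∀ l, PowerSeries.coeff l (F * G) ∈ vertexSupport {t | monoWeight t + l = n + m} := by
    intro n m F G hF hG l
    rw [PowerSeries.coeff_mul]
    refine Submodule.sum_mem _ fun p hp => ?_
    replace hp : p.1 + p.2 = l := by simpa using hp
    refine mul_mem_vertexSupport (fun s hs t ht => ?_) (hF p.1) (hG p.2)
    rw [Set.mem_ofPred_eq] at *
    rw [monoWeight_add]
    omega
  have hone : ∀ l, PowerSeries.coeff l (1 : PowerSeries Fock) ∈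
      vertexSupport {t | monoWeight t + l = 0} := by
    intro l
    rw [PowerSeries.coeff_one]
    split_ifs with h
    · rw [h, ← map_one vertexHom]
      exact vertexHom_monomial_mem (by simp [monoWeight])
    · exact Submodule.zero_mem _
  have hX : ∀ i l : ℕ, PowerSeries.coeff l (shiftHom rootTwo (vertexHom (MvPolynomial.X i))) ∈
      vertexSupport {t | monoWeight t + l = i + 1} := by
    intro i l
    rw [coeff_shiftHom, vertexHom_X, annihilCoeff_vertexPoly]
    refine Submodule.smul_mem _ _ (vertexSupport_mono (fun t ht => ?_) (vertexPoly_mem _))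
    rw [Set.mem_ofPred_eq] at *
    omega
  induction s using Finsupp.induction_linear with
  | zero =>
    rw [MvPolynomial.monomial_zero', MvPolynomial.C_1, map_one, map_one]
    exact hone
  | add s t hs ht =>
    rw [← one_mul (1 : ℂ), ← MvPolynomial.monomial_mul, map_mul, map_mul, monoWeight_add]
    exact hmul _ _ _ _ hs ht
  | single i c =>
    rw [monoWeight_single, ← MvPolynomial.X_pow_eq_monomial, map_pow, map_pow]
    induction c with
    | zero =>
      rw [pow_zero, zero_mul]
      exact hone
    | succ c ih =>
      rw [pow_succ, add_mul, one_mul]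
      exact hmul _ _ _ _ ih (hX i)

theorem annihilCoeff_mem_vertexSupport {n : ℕ} {f : Fock}
    (hf : f ∈ vertexSupport {t | monoWeight t = n}) (l : ℕ) :
    annihilCoeff rootTwo l f ∈ vertexSupport {t | monoWeight t + l = n} := by
  obtain ⟨g, hg, rfl⟩ := hf
  rw [SetLike.mem_coe, MvPolynomial.restrictSupport_eq_span] at hg
  induction hg using Submodule.span_induction with
  | zero => simp
  | add x y _ _ hx hy => rw [map_add, map_add]; exact Submodule.add_mem _ hx hy
  | smul c x _ hx => rw [map_smul, map_smul]; exact Submodule.smul_mem _ _ hx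
  | mem x hx =>
    obtain ⟨s, hs, rfl⟩ := hx
    rw [← show monoWeight s = n from hs]
    have h := coeff_shiftHom_vertexHom_monomial_mem s l
    rwa [coeff_shiftHom] at h

/-- The leading term of a mode of a vertex operator. -/
theorem fockVertexCoeff_sub_mem {n : ℕ} {f : Fock}
    (hf : f ∈ vertexSupport {t | monoWeight t = n}) (i : ℕ) :
    fockVertexCoeff rootTwo ((i + 1 : ℕ) : ℤ) f - vertexPoly rootTwo ((i + 1 : ℕ) : ℤ) * f ∈
      vertexSupport {t | (∃ k, i < k ∧ t k ≠ 0) ∧ monoWeight t = i + 1 + n} := by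
  have h0 : vertexPoly rootTwo ((i + 1 : ℕ) : ℤ) * f = ∑ᶠ l : ℤ,
      if l = 0 then vertexPoly rootTwo ((i + 1 : ℕ) : ℤ) * f else 0 := by
    rw [finsum_eq_single _ 0 fun l hl => if_neg hl, if_pos rfl]
  have hfin : (Function.support fun l : ℤ =>
      if l = 0 then vertexPoly rootTwo ((i + 1 : ℕ) : ℤ) * f else 0).Finite := by
    refine (Set.finite_singleton (0 : ℤ)).subset fun l hl => ?_
    by_contra h
    exact hl (if_neg h)
  rw [fockVertexCoeff_apply, h0, ← finsum_sub_distrib (finite_support_mul_annihilCoeff _ _ _) hfin]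
  refine finsum_induction (fun g => g ∈ vertexSupport _) (Submodule.zero_mem _)
    (fun _ _ => Submodule.add_mem _) fun l => ?_
  rcases lt_trichotomy l 0 with h | rfl | h
  · rw [annihilCoeff_of_neg _ h, if_neg h.ne, LinearMap.zero_apply, mul_zero, sub_zero]
    exact Submodule.zero_mem _
  · rw [annihilCoeff_zero, if_pos rfl, Module.End.one_apply, add_zero, sub_self]
    exact Submodule.zero_mem _
  -- Each further term has a creation factor of strictly larger index, i.e. the generator i + m + 1
  -- > i.
  · obtain ⟨m, rfl⟩ : ∃ m : ℕ, l = ((m + 1 : ℕ) : ℤ) := ⟨(l - 1).toNat, by omega⟩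
    rw [if_neg h.ne', sub_zero, ← Nat.cast_add, show i + 1 + (m + 1) = (i + m + 1) + 1 by ring]
    refine mul_mem_vertexSupport ?_
      (vertexPoly_succ_mem (Set.mem_singleton (Finsupp.single (i + m + 1) 1)))
      (annihilCoeff_mem_vertexSupport hf (m + 1))
    rintro _ rfl t ht
    rw [Set.mem_ofPred_eq] at *
    refine ⟨⟨i + m + 1, by omega, by simp⟩, ?_⟩
    rw [monoWeight_add, monoWeight_single]
    omega

/-! ### Products of modes applied to the vacuum -/

/-- The vector `U_{i₁+1} U_{i₂+1} ⋯ 1`, where `U_d` is the coefficient of `zᵈ` in the vertex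
operator on a Fock space. -/
def fockMonomial : List ℕ → Fock
  | [] => 1
  | i :: L => fockVertexCoeff rootTwo ((i + 1 : ℕ) : ℤ) (fockMonomial L)

theorem toFinsupp_cons (i : ℕ) (L : List ℕ) : Multiset.toFinsupp (↑(i :: L) : Multiset ℕ) =
    Finsupp.single i 1 + Multiset.toFinsupp (L : Multiset ℕ) := by
  rw [← Multiset.cons_coe, ← Multiset.singleton_add, Multiset.toFinsupp_add,
    Multiset.toFinsupp_singleton]

/-- The first entry i bounds the whole list, so the corrections from its vertex coefficient, which
contain a generator beyond i, are colex-larger. Corrections from the tail stay larger after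
multiplication by the leading generator. -/
theorem fockMonomial_sub_mem (L : List ℕ) (hL : L.Pairwise (· ≥ ·)) :
    fockMonomial L - vertexHom (MvPolynomial.monomial (Multiset.toFinsupp (L : Multiset ℕ)) 1) ∈
      vertexSupport {t | ColexLT (Multiset.toFinsupp (L : Multiset ℕ)) t ∧
        monoWeight t = monoWeight (Multiset.toFinsupp (L : Multiset ℕ))} := by
  induction L with
  | nil =>
    rw [fockMonomial, Multiset.coe_nil, map_zero, MvPolynomial.monomial_zero', MvPolynomial.C_1,
      map_one, sub_self]
    exact Submodule.zero_mem _
  | cons i L ih =>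
    rw [List.pairwise_cons] at hL
    specialize ih hL.2
    have hsupp : ∀ k, i < k → Multiset.toFinsupp (↑(i :: L) : Multiset ℕ) k = 0 := by
      intro k hk
      rw [Multiset.toFinsupp_apply, Multiset.count_eq_zero, Multiset.mem_coe, List.mem_cons]
      rintro (rfl | h)
      · exact lt_irrefl _ hk
      · exact absurd (hL.1 k h) (not_le.2 hk)
    rw [toFinsupp_cons] at *
    generalize Multiset.toFinsupp (L : Multiset ℕ) = s at *
    have hv : fockMonomial L ∈ vertexSupport {t | monoWeight t = monoWeight s} := by
      rw [← sub_add_cancel (fockMonomial L) (vertexHom (MvPolynomial.monomial s 1))]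
      exact Submodule.add_mem _ (vertexSupport_mono (fun t ht => ht.2) ih)
        (vertexHom_monomial_mem rfl)
    have hm : vertexHom (MvPolynomial.monomial (Finsupp.single i 1 + s) 1) =
        vertexPoly rootTwo ((i + 1 : ℕ) : ℤ) * vertexHom (MvPolynomial.monomial s 1) := by
      rw [← one_mul (1 : ℂ), ← MvPolynomial.monomial_mul, map_mul, one_mul, ← vertexHom_X]
      rfl
    rw [fockMonomial, hm, ← sub_add_sub_cancel _
      (vertexPoly rootTwo ((i + 1 : ℕ) : ℤ) * fockMonomial L), ← mul_sub]
    refine Submodule.add_mem _ (vertexSupport_mono ?_ (fockVertexCoeff_sub_mem hv i))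
      (mul_mem_vertexSupport ?_ (vertexPoly_succ_mem (Set.mem_singleton _)) ih)
    · rintro t ⟨⟨k, hk, htk⟩, hw⟩
      refine ⟨colexLT_of_apply_ne_zero (fun j hj => hsupp j (hk.trans_le hj)) htk, ?_⟩
      rw [hw, monoWeight_add, monoWeight_single, one_mul]
    · rintro _ rfl t ⟨ht, hw⟩
      refine ⟨ht.add_left _, ?_⟩
      rw [monoWeight_add, monoWeight_add, hw]

/-- The exponent vector as a decreasing list. -/
def exponentList (s : ℕ →₀ ℕ) : List ℕ := (Finsupp.toMultiset s).sort (· ≥ ·)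

theorem pairwise_exponentList (s : ℕ →₀ ℕ) : (exponentList s).Pairwise (· ≥ ·) :=
  Multiset.pairwise_sort _ _

theorem toFinsupp_exponentList (s : ℕ →₀ ℕ) :
    Multiset.toFinsupp (exponentList s : Multiset ℕ) = s := by
  rw [exponentList, Multiset.sort_eq]
  exact Finsupp.toMultiset_toFinsupp s

/-- After undoing `vertexHom`, the map from monomials to these vectors is unitriangular. -/
theorem exists_fockBasis :
    ∃ b : Module.Basis (ℕ →₀ ℕ) ℂ Fock, ∀ s, b s = fockMonomial (exponentList s) := by
  let φ : Fock ≃ₐ[ℂ] Fock := AlgEquiv.ofBijective vertexHom vertexHom_bijective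
  have hφ : ∀ f, φ f = vertexHom f := fun _ => rfl
  let T : Module.End ℂ Fock := (MvPolynomial.basisMonomials ℕ ℂ).constr ℂ
    fun s => φ.symm (fockMonomial (exponentList s))
  have hT : ∀ s, T (MvPolynomial.monomial s 1) = φ.symm (fockMonomial (exponentList s)) := by
    intro s
    have h := (MvPolynomial.basisMonomials ℕ ℂ).constr_basis ℂ
      (fun s => φ.symm (fockMonomial (exponentList s))) s
    rwa [MvPolynomial.coe_basisMonomials] at h
  have hbij : Function.Bijective T := by
    refine bijective_of_triangular T fun s => ?_
    have h := fockMonomial_sub_mem _ (pairwise_exponentList s)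
    rw [toFinsupp_exponentList] at h
    obtain ⟨g, hg, hgs⟩ := h
    have h1 : g = T (MvPolynomial.monomial s 1) - MvPolynomial.monomial s 1 := by
      apply φ.injective
      rw [map_sub, hT, AlgEquiv.apply_symm_apply, hφ, hφ]
      exact hgs
    rw [← h1]
    exact hg
  refine ⟨(MvPolynomial.basisMonomials ℕ ℂ).map
    ((LinearEquiv.ofBijective T hbij).trans φ.toLinearEquiv), fun s => ?_⟩
  rw [Module.Basis.map_apply, MvPolynomial.coe_basisMonomials]
  change φ (T (MvPolynomial.monomial s 1)) = _
  rw [hT, AlgEquiv.apply_symm_apply]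

/-! ### Fibonacci configurations and partitions -/

/-- The parts of the partition with parts `i + 1`, `i` in the list, followed by zeros. -/
def partSeq : List ℕ → ℕ → ℕ
  | [], _ => 0
  | i :: _, 0 => i + 1
  | _ :: L, k + 1 => partSeq L k

theorem partSeq_of_length_le (L : List ℕ) (k : ℕ) (h : L.length ≤ k) : partSeq L k = 0 := by
  induction L generalizing k with
  | nil => rfl
  | cons i L ih =>
    cases k with
    | zero => simp at h
    | succ k => exact ih k (by simpa using h)

theorem partSeq_succ_le (L : List ℕ) (hL : L.Pairwise (· ≥ ·)) (k : ℕ) :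
    partSeq L (k + 1) ≤ partSeq L k := by
  induction L generalizing k with
  | nil => exact le_rfl
  | cons i L ih =>
    rw [List.pairwise_cons] at hL
    cases k with
    | zero =>
      cases L with
      | nil => exact Nat.zero_le _
      | cons i' L => exact Nat.succ_le_succ (hL.1 i' (by simp))
    | succ k => exact ih hL.2 k

theorem partSeq_injective : Function.Injective partSeq := by
  intro L
  induction L with
  | nil =>
    intro L' h
    cases L' with
    | nil => rfl
    | cons i L' => exact absurd (congrFun h 0) (by simp [partSeq])
  | cons i L ih =>
    intro L' h
    cases L' with
    | nil => exact absurd (congrFun h 0) (by simp [partSeq])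
    | cons i' L' =>
      have h0 : i + 1 = i' + 1 := congrFun h 0
      rw [Nat.succ_injective h0, ih (funext fun k => congrFun h (k + 1))]

theorem exists_partSeq_eq_succ {L : List ℕ} {i : ℕ} (h : i ∈ L) : ∃ k, partSeq L k = i + 1 := by
  induction L with
  | nil => simp at h
  | cons i' L ih =>
    rcases List.mem_cons.1 h with rfl | h
    · exact ⟨0, rfl⟩
    · obtain ⟨k, hk⟩ := ih h
      exact ⟨k + 1, hk⟩

theorem exists_partSeq_eq (K : ℕ) : ∀ p : ℕ → ℕ, Antitone p → (∀ k, K ≤ k → p k = 0) →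
    ∃ L : List ℕ, L.Pairwise (· ≥ ·) ∧ partSeq L = p := by
  induction K with
  | zero => exact fun p _ h0 => ⟨[], List.Pairwise.nil, funext fun k => (h0 k (Nat.zero_le k)).symm⟩
  | succ K ih =>
    intro p hp h0
    rcases Nat.eq_zero_or_pos (p 0) with h | h
    · exact ⟨[], List.Pairwise.nil, funext fun k => (Nat.le_zero.1 (h ▸ hp (Nat.zero_le k))).symm⟩
    · obtain ⟨L, hL, hLp⟩ := ih (fun k => p (k + 1)) (fun a b hab => hp (Nat.succ_le_succ hab))
        fun k hk => h0 _ (Nat.succ_le_succ hk)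
      refine ⟨(p 0 - 1) :: L, List.pairwise_cons.2 ⟨fun i hi => ?_, hL⟩, funext fun k => ?_⟩
      · obtain ⟨k, hk⟩ := exists_partSeq_eq_succ hi
        have h1 : p (k + 1) = i + 1 := by rw [← hk, hLp]
        have h2 := hp (Nat.zero_le (k + 1))
        change i ≤ p 0 - 1
        omega
      · cases k with
        | zero => exact Nat.sub_add_cancel h
        | succ k => exact congrFun hLp k

theorem exponentList_toFinsupp {L : List ℕ} (hL : L.Pairwise (· ≥ ·)) :
    exponentList (Multiset.toFinsupp (L : Multiset ℕ)) = L := by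
  refine List.Perm.eq_of_pairwise' (r := (· ≥ ·)) (pairwise_exponentList _) hL ?_
  rw [← Multiset.coe_eq_coe]
  apply Multiset.toFinsupp.injective
  rw [toFinsupp_exponentList]

/-! ### From configurations to charges and partitions -/

namespace FibConfig

variable (c : FibConfig 1 1)

theorem eq_zero_or_succ_eq_zero (i : ℤ) : c.a i = 0 ∨ c.a (i + 1) = 0 := by
  have h := c.window i
  rw [show Finset.Icc i (i + 1) = {i, i + 1} by ext k; simp; omega,
    Finset.sum_pair (by omega)] at h
  omega

theorem exists_forall_lt : ∃ B : ℤ, ∀ i < B, c.a i ≠ 0 ↔ i % 2 = 1 := by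
  obtain ⟨B, hB⟩ := c.eventually_periodic
  refine ⟨-B, fun i hi => ?_⟩
  have h := hB (-i) (by omega)
  rw [neg_neg] at h
  rw [h]
  split_ifs with h1
  · exact iff_of_true one_ne_zero h1
  · exact iff_of_false (not_not.2 rfl) h1

theorem exists_lt (m : ℤ) : ∃ i < m, c.a i ≠ 0 := by
  obtain ⟨B, hB⟩ := c.exists_forall_lt
  rcases Int.emod_two_eq_zero_or_one (min B m) with h | h
  · exact ⟨min B m - 1, by omega, (hB _ (by omega)).2 (by omega)⟩
  · exact ⟨min B m - 2, by omega, (hB _ (by omega)).2 (by omega)⟩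

/-- The set of ones is nonempty by the periodic tail and bounded above, so the supremum is attained
rather than a default value. -/
theorem isGreatest_onePos_zero : IsGreatest {i | c.a i ≠ 0} (onePos c 0) := by
  obtain ⟨B, hB⟩ := c.eventually_zero
  have hne : {i | c.a i ≠ 0}.Nonempty := by
    obtain ⟨i, -, hi⟩ := c.exists_lt 0
    exact ⟨i, hi⟩
  have hb : BddAbove {i | c.a i ≠ 0} :=
    ⟨B, fun i hi => not_lt.1 fun h => hi (hB i h)⟩
  exact ⟨Int.csSup_mem hne hb, fun i hi => le_csSup hb hi⟩

theorem isGreatest_onePos_succ (k : ℕ) :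
    IsGreatest {i | c.a i ≠ 0 ∧ i < onePos c k} (onePos c (k + 1)) := by
  have hne : {i | c.a i ≠ 0 ∧ i < onePos c k}.Nonempty := by
    obtain ⟨i, h, hi⟩ := c.exists_lt (onePos c k)
    exact ⟨i, hi, h⟩
  have hb : BddAbove {i | c.a i ≠ 0 ∧ i < onePos c k} := ⟨onePos c k, fun i hi => hi.2.le⟩
  exact ⟨Int.csSup_mem hne hb, fun i hi => le_csSup hb hi⟩

theorem onePos_ne_zero (k : ℕ) : c.a (onePos c k) ≠ 0 := by
  cases k with
  | zero => exact c.isGreatest_onePos_zero.1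
  | succ k => exact (c.isGreatest_onePos_succ k).1.1

theorem onePos_succ_le (k : ℕ) : onePos c (k + 1) ≤ onePos c k - 2 := by
  have h1 : onePos c (k + 1) < onePos c k := (c.isGreatest_onePos_succ k).1.2
  have h2 : onePos c (k + 1) ≠ onePos c k - 1 := fun h => by
    rcases c.eq_zero_or_succ_eq_zero (onePos c (k + 1)) with h0 | h0
    · exact c.onePos_ne_zero _ h0
    · rw [h, sub_add_cancel] at h0
      exact c.onePos_ne_zero _ h0
  omega

theorem onePos_le (k : ℕ) : onePos c k ≤ onePos c 0 - 2 * k := by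
  induction k with
  | zero => simp
  | succ k ih =>
    have h := c.onePos_succ_le k
    push_cast
    omega

/-- The listed positions drop by at least 2 at each step, so they eventually pass below any given
one and cannot skip it. -/
theorem ne_zero_iff_mem_range (i : ℤ) : c.a i ≠ 0 ↔ i ∈ Set.range (onePos c) := by
  constructor
  · intro hi
    have hex : ∃ k, onePos c k ≤ i := by
      refine ⟨(onePos c 0 - i).toNat, ?_⟩
      have h := c.onePos_le (onePos c 0 - i).toNat
      have h1 := c.isGreatest_onePos_zero.2 hi
      omega
    classical
    have hk := Nat.find_spec hex
    refine ⟨Nat.find hex, le_antisymm hk ?_⟩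
    rcases h : Nat.find hex with _ | k
    · exact c.isGreatest_onePos_zero.2 hi
    · exact (c.isGreatest_onePos_succ k).2
        ⟨hi, not_le.1 (Nat.find_min hex (m := k) (by omega))⟩
  · rintro ⟨k, rfl⟩
    exact c.onePos_ne_zero k

theorem tau_injective : Function.Injective (tau : FibConfig 1 1 → ℕ → ℤ) := by
  intro c c' h
  have h1 : onePos c = onePos c' := funext fun k => neg_injective (congrFun h k)
  have h2 : c.a = c'.a := by
    funext i
    have h3 := (c.ne_zero_iff_mem_range i).trans ((h1 ▸ c'.ne_zero_iff_mem_range i).symm)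
    have h4 := c.zero_or_one i
    have h5 := c'.zero_or_one i
    omega
  cases c
  cases c'
  cases h2
  rfl

theorem exists_onePos_eq : ∃ (j : ℤ) (K : ℕ), ∀ k, K ≤ k → onePos c k = 2 * j - 1 - 2 * k := by
  obtain ⟨B, hB⟩ := c.exists_forall_lt
  have hlt : ∀ k, (onePos c 0 - B).toNat + 1 ≤ k → onePos c k < B := fun k hk => by
    have h := c.onePos_le k
    omega
  have hodd : ∀ k, (onePos c 0 - B).toNat + 1 ≤ k → onePos c k % 2 = 1 := fun k hk =>
    (hB _ (hlt k hk)).1 (c.onePos_ne_zero k)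
  have hstep : ∀ k, (onePos c 0 - B).toNat + 1 ≤ k → onePos c (k + 1) = onePos c k - 2 :=
    fun k hk => by
      refine le_antisymm (c.onePos_succ_le k) ((c.isGreatest_onePos_succ k).2 ⟨?_, by omega⟩)
      have h1 := hlt k hk
      have h2 := hodd k hk
      exact (hB _ (by omega)).2 (by omega)
  generalize (onePos c 0 - B).toNat + 1 = K at *
  refine ⟨(onePos c K + 1) / 2 + K, K, fun k hk => ?_⟩
  induction k, hk using Nat.le_induction with
  | base =>
    have := hodd K le_rfl
    omega
  | succ k hk ih =>
    rw [hstep k hk, ih]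
    push_cast
    ring

/-- The tail fixes j. Gaps of at least 2 say exactly that the deviation from the vacuum sequence is
decreasing, and it ends in zeros: it is a partition. -/
theorem exists_tau_eq : ∃ (j : ℤ) (s : ℕ →₀ ℕ),
    ∀ k, tau c k = 2 * k + 1 - 2 * j - partSeq (exponentList s) k := by
  obtain ⟨j, K, hK⟩ := c.exists_onePos_eq
  have hanti : Antitone fun k : ℕ => onePos c k + 2 * k + 1 - 2 * j :=
    antitone_nat_of_succ_le fun k => by
      have h := c.onePos_succ_le k
      push_cast
      omega
  have hnonneg : ∀ k : ℕ, 0 ≤ onePos c k + 2 * k + 1 - 2 * j := fun k => by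
    have h := hanti (le_max_left k K)
    have h1 := hK (max k K) (le_max_right k K)
    simp only at h
    omega
  obtain ⟨L, hL, hLp⟩ := exists_partSeq_eq K (fun k => (onePos c k + 2 * k + 1 - 2 * j).toNat)
    (fun a b hab => Int.toNat_le_toNat (hanti hab)) fun k hk => by
      have h1 := hK k hk
      omega
  refine ⟨j, Multiset.toFinsupp (L : Multiset ℕ), fun k => ?_⟩
  rw [exponentList_toFinsupp hL, hLp, tau, Int.toNat_of_nonneg (hnonneg k)]
  ring

end FibConfig

/-! ### From charges and partitions back to configurations -/

theorem add_two_le_of_lt {t : ℕ → ℤ} (ht : ∀ k, t k + 2 ≤ t (k + 1)) {k l : ℕ} (h : k < l) :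
    t k + 2 ≤ t l := by
  induction l, h using Nat.le_induction with
  | base => exact ht k
  | succ l _ ih =>
    have := ht l
    omega

open Classical in
/-- The configuration with ones at the negatives of the terms of a sequence. -/
def fibConfigOfSeq {t : ℕ → ℤ} (ht : ∀ k, t k + 2 ≤ t (k + 1)) {j : ℤ} {K : ℕ}
    (hK : ∀ k, K ≤ k → t k = 2 * k + 1 - 2 * j) :
    FibConfig 1 1 where
  a i := if -i ∈ Set.range t then 1 else 0
  zero_or_one i := by
    split_ifs <;> simp
  window i := by
    rw [show Finset.Icc i (i + 1) = {i, i + 1} by ext k; simp; omega,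
      Finset.sum_pair (by omega)]
    split_ifs with h1 h2
    · obtain ⟨k, hk⟩ := h1
      obtain ⟨l, hl⟩ := h2
      rcases lt_trichotomy k l with h | rfl | h
      · have := add_two_le_of_lt ht h
        omega
      · omega
      · have := add_two_le_of_lt ht h
        omega
    all_goals simp
  eventually_zero := by
    refine ⟨-t 0, fun i hi => if_neg ?_⟩
    rintro ⟨k, hk⟩
    rcases Nat.eq_zero_or_pos k with rfl | h
    · omega
    · have := add_two_le_of_lt ht h
      omega
  eventually_periodic := by
    refine ⟨t K, fun n hn => if_congr ?_ rfl rfl⟩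
    rw [neg_neg, Int.ModEq]
    constructor
    · rintro ⟨k, rfl⟩
      rcases lt_or_ge k K with h | h
      · have := add_two_le_of_lt ht h
        omega
      · have := hK k h
        omega
    · intro h
      have h1 := hK K le_rfl
      -- The solution k of 2k + 1 - 2j = n; as n exceeds the K-th term, k lies in the range where
      -- the tail formula holds.
      refine ⟨((n - 1 + 2 * j) / 2).toNat, ?_⟩
      rw [hK _ (by omega)]
      omega

theorem fibConfigOfSeq_ne_zero {t : ℕ → ℤ} (ht : ∀ k, t k + 2 ≤ t (k + 1)) {j : ℤ} {K : ℕ}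
    (hK : ∀ k, K ≤ k → t k = 2 * k + 1 - 2 * j) (i : ℤ) :
    (fibConfigOfSeq ht hK).a i ≠ 0 ↔ -i ∈ Set.range t := by
  simp [fibConfigOfSeq]

theorem onePos_fibConfigOfSeq {t : ℕ → ℤ} (ht : ∀ k, t k + 2 ≤ t (k + 1)) {j : ℤ} {K : ℕ}
    (hK : ∀ k, K ≤ k → t k = 2 * k + 1 - 2 * j) (k : ℕ) :
    onePos (fibConfigOfSeq ht hK) k = -t k := by
  induction k with
  | zero =>
    refine IsGreatest.unique (FibConfig.isGreatest_onePos_zero _) ⟨?_, fun i hi => ?_⟩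
    · rw [Set.mem_ofPred_eq, fibConfigOfSeq_ne_zero, neg_neg]
      exact ⟨0, rfl⟩
    · rw [Set.mem_ofPred_eq, fibConfigOfSeq_ne_zero] at hi
      obtain ⟨k, hk⟩ := hi
      rcases Nat.eq_zero_or_pos k with rfl | h
      · omega
      · have := add_two_le_of_lt ht h
        omega
  | succ k ih =>
    refine IsGreatest.unique (FibConfig.isGreatest_onePos_succ _ k) ⟨?_, fun i hi => ?_⟩
    · rw [Set.mem_ofPred_eq, fibConfigOfSeq_ne_zero, neg_neg, ih]
      have := ht k
      exact ⟨⟨k + 1, rfl⟩, by omega⟩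
    · rw [Set.mem_ofPred_eq, fibConfigOfSeq_ne_zero, ih] at hi
      obtain ⟨⟨l, hl⟩, hi⟩ := hi
      rcases lt_trichotomy l (k + 1) with h | rfl | h
      · rcases (Nat.lt_succ_iff.1 h).lt_or_eq with h | rfl
        · have := add_two_le_of_lt ht h
          omega
        · omega
      · omega
      · have := add_two_le_of_lt ht h
        omega

theorem exists_fibConfig_tau_eq (j : ℤ) (s : ℕ →₀ ℕ) : ∃ c : FibConfig 1 1,
    ∀ k, tau c k = 2 * k + 1 - 2 * j - partSeq (exponentList s) k := by
  have ht : ∀ k : ℕ, (2 * k + 1 - 2 * j - partSeq (exponentList s) k : ℤ) + 2 ≤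
      2 * (k + 1 : ℕ) + 1 - 2 * j - partSeq (exponentList s) (k + 1) := fun k => by
    have h := partSeq_succ_le _ (pairwise_exponentList s) k
    push_cast
    omega
  have hK : ∀ k : ℕ, (exponentList s).length ≤ k →
      (2 * k + 1 - 2 * j - partSeq (exponentList s) k : ℤ) = 2 * k + 1 - 2 * j := fun k hk => by
    rw [partSeq_of_length_le _ k hk]
    simp
  refine ⟨fibConfigOfSeq (t := fun k => 2 * k + 1 - 2 * j - partSeq (exponentList s) k) ht hK,
    fun k => ?_⟩
  rw [tau, onePos_fibConfigOfSeq, neg_neg]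

theorem eq_of_tau_formula_eq {j j' : ℤ} {s s' : ℕ →₀ ℕ}
    (h : ∀ k : ℕ, (2 * k + 1 - 2 * j - partSeq (exponentList s) k : ℤ) =
      2 * k + 1 - 2 * j' - partSeq (exponentList s') k) : j = j' ∧ s = s' := by
  have hj : j = j' := by
    have h1 := h (max (exponentList s).length (exponentList s').length)
    rw [partSeq_of_length_le _ _ (le_max_left _ _),
      partSeq_of_length_le _ _ (le_max_right _ _)] at h1
    omega
  refine ⟨hj, ?_⟩
  have hL : exponentList s = exponentList s' := partSeq_injective (funext fun k => by
    have h1 := h k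
    omega)
  rw [← toFinsupp_exponentList s, hL, toFinsupp_exponentList]

theorem exists_fibConfig_equiv : ∃ E : FibConfig 1 1 ≃ (_ : ℤ) × (ℕ →₀ ℕ),
    ∀ c k, tau c k = 2 * k + 1 - 2 * (E c).1 - partSeq (exponentList (E c).2) k := by
  choose j s hjs using FibConfig.exists_tau_eq
  have hbij : Function.Bijective fun c => (⟨j c, s c⟩ : (_ : ℤ) × (ℕ →₀ ℕ)) := by
    constructor
    · intro c c' h
      simp only [Sigma.mk.injEq, heq_eq_eq] at h
      refine FibConfig.tau_injective (funext fun k => ?_)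
      rw [hjs, hjs, h.1, h.2]
    · rintro ⟨i, u⟩
      obtain ⟨c, hc⟩ := exists_fibConfig_tau_eq i u
      obtain ⟨h1, h2⟩ := eq_of_tau_formula_eq fun k => (hjs c k).symm.trans (hc k)
      exact ⟨c, by simp only [h1, h2]⟩
  exact ⟨Equiv.ofBijective _ hbij, hjs⟩

/-! ### Semi-infinite monomials -/

/-- Removing the first factor lowers the charge by 1 and drops the first part, and e of index 1 - 2j
- λ_0 acts from charge j - 1 to j as the vertex coefficient of degree λ_0. -/
theorem prod_eMode_vac (k : ℕ) : ∀ (L : List ℕ) (j : ℤ) (t : ℕ → ℤ),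
    (∀ i, t i = 2 * i + 1 - 2 * j - partSeq L i) → L.length ≤ k →
    ((List.range k).map fun i => eMode (t i)).prod (vac ((1 - t k) / 2)) =
      Finsupp.single j (fockMonomial L) := by
  induction k with
  | zero =>
    intro L j t ht hL
    obtain rfl := List.length_eq_zero_iff.1 (Nat.le_zero.1 hL)
    rw [List.range_zero, List.map_nil, List.prod_nil, Module.End.one_apply, ht, vac, fockMonomial]
    congr 1
    simp only [partSeq]
    omega
  | succ k ih =>
    intro L j t ht hL
    have hstep : ∀ L' : List ℕ, (∀ i, partSeq L (i + 1) = partSeq L' i) → L'.length ≤ k →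
        ((List.range (k + 1)).map fun i => eMode (t i)).prod (vac ((1 - t (k + 1)) / 2)) =
          eMode (t 0) (Finsupp.single (j - 1) (fockMonomial L')) := by
      intro L' hL' hk
      rw [List.range_succ_eq_map, List.map_cons, List.prod_cons, Module.End.mul_apply,
        List.map_map]
      congr 1
      refine ih L' (j - 1) (fun i => t (i + 1)) (fun i => ?_) hk
      rw [ht, hL']
      push_cast
      ring
    cases L with
    | nil =>
      -- Beyond the parts, an extra factor merely raises one vacuum to the next; hence truncations
      -- stabilize.
      rw [hstep [] (fun _ => rfl) (Nat.zero_le k), ht]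
      have h := eMode_vac (j - 1)
      rw [sub_add_cancel] at h
      have h0 : (2 * ((0 : ℕ) : ℤ) + 1 - 2 * j - (partSeq [] 0 : ℕ)) = -1 - 2 * (j - 1) := by
        simp only [partSeq]
        push_cast
        ring
      rw [h0]
      exact h
    | cons i L =>
      rw [hstep L (fun _ => rfl) (by simpa using hL), ht, eMode_single, sub_add_cancel,
        fockMonomial]
      congr 2
      refine congrArg _ ?_
      simp only [partSeq]
      push_cast
      ring

theorem exists_basis_truncatedMonomial : ∃ b : Module.Basis (FibConfig 1 1) ℂ LatticeV,
    ∀ c : FibConfig 1 1, ∀ᶠ k in atTop, truncatedMonomial c k = b c := by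
  obtain ⟨b, hb⟩ := exists_fockBasis
  obtain ⟨E, hE⟩ := exists_fibConfig_equiv
  refine ⟨(Finsupp.basis fun _ : ℤ => b).reindex E.symm, fun c => ?_⟩
  filter_upwards [eventually_ge_atTop (exponentList (E c).2).length] with k hk
  rw [Module.Basis.reindex_apply, Equiv.symm_symm, Finsupp.coe_basis]
  change _ = Finsupp.single (E c).1 (b (E c).2)
  rw [hb]
  exact prod_eMode_vac k _ _ _ (hE c) hk

/-! ### The basic subspaces -/

theorem mem_basicSubspace_iff {j : ℤ} {v : LatticeV} : v ∈ basicSubspace j ↔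
    ∃ A ∈ Algebra.adjoin ℂ (Set.range eMode), A (vac j) = v := Iff.rfl

/-- Each vacuum arises from the previous one by an e-mode. The nesting makes the union closed under
addition. -/
theorem basicSubspace_antitone : Antitone basicSubspace := by
  refine antitone_int_of_succ_le fun j v hv => ?_
  obtain ⟨A, hA, rfl⟩ := mem_basicSubspace_iff.1 hv
  refine mem_basicSubspace_iff.2 ⟨A * eMode (-1 - 2 * j),
    Subalgebra.mul_mem _ hA (Algebra.subset_adjoin ⟨_, rfl⟩), ?_⟩
  rw [Module.End.mul_apply, eMode_vac]

theorem truncatedMonomial_mem (c : FibConfig 1 1) (k : ℕ) :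
    truncatedMonomial c k ∈ basicSubspace ((1 - tau c k) / 2) := by
  refine mem_basicSubspace_iff.2 ⟨_, Subalgebra.list_prod_mem _ fun x hx => ?_, rfl⟩
  obtain ⟨i, -, rfl⟩ := List.mem_map.1 hx
  exact Algebra.subset_adjoin ⟨_, rfl⟩

theorem iUnion_basicSubspace : (⋃ j : ℤ, (basicSubspace j : Set LatticeV)) = Set.univ := by
  obtain ⟨b, hb⟩ := exists_basis_truncatedMonomial
  refine Set.eq_univ_of_forall fun v => Set.mem_iUnion.2 ?_
  have hv : v ∈ Submodule.span ℂ (Set.range b) := by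
    rw [b.span_eq]
    trivial
  induction hv using Submodule.span_induction with
  | zero => exact ⟨0, Submodule.zero_mem _⟩
  | add x y _ _ hx hy =>
    obtain ⟨i, hi⟩ := hx
    obtain ⟨j, hj⟩ := hy
    exact ⟨min i j, Submodule.add_mem _ (basicSubspace_antitone (min_le_left i j) hi)
      (basicSubspace_antitone (min_le_right i j) hj)⟩
  | smul a x _ hx =>
    obtain ⟨i, hi⟩ := hx
    exact ⟨i, Submodule.smul_mem _ a hi⟩
  | mem x hx =>
    obtain ⟨c, rfl⟩ := hx
    obtain ⟨k, hk⟩ := (hb c).exists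
    exact ⟨_, hk ▸ truncatedMonomial_mem c k⟩

end FeiginStoyanovsky

end

/-! ### The main theorem -/

open FeiginStoyanovsky in
theorem mainTheorem7 :
    ∃ (_ : LieRingModule AffineSl2 LatticeV) (_ : LieModule ℂ AffineSl2 LatticeV),
      -- the action of the affine Lie algebra on the lattice vertex algebra
      (∀ (n : ℤ) (v : LatticeV), ⁅loopElt sl2E n, v⁆ = eMode n v) ∧
      (∀ (n : ℤ) (v : LatticeV), ⁅loopElt sl2F n, v⁆ = fMode n v) ∧
      (∀ (n : ℤ) (v : LatticeV), ⁅loopElt sl2H n, v⁆ = rootTwo • heisMode n v) ∧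
      (∀ v : LatticeV, ⁅centralK, v⁆ = v) ∧
      -- it is the standard module of highest weight `(0, 1)`
      IsHighestWeightModule 0 1 LatticeV ∧
      -- the union of the basic subspaces is invariant, and is everything
      (∀ (x : AffineSl2), ∀ v ∈ ⋃ j : ℤ, (basicSubspace j : Set LatticeV),
        ⁅x, v⁆ ∈ ⋃ j : ℤ, (basicSubspace j : Set LatticeV)) ∧
      (⋃ j : ℤ, (basicSubspace j : Set LatticeV)) = Set.univ ∧
      -- the semi-infinite monomials are well defined and form a basis
      ∃ b : Module.Basis (FibConfig 1 1) ℂ LatticeV,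
        ∀ c : FibConfig 1 1, ∀ᶠ k in atTop, truncatedMonomial c k = b c := by
  refine ⟨affineLieRingModule, affineLieModule, fun n v => ?_, fun n v => ?_, fun n v => ?_,
    fun v => ?_, isHighestWeightModule_latticeV, fun x v _ => ?_, iUnion_basicSubspace,
    exists_basis_truncatedMonomial⟩
  · exact LinearMap.congr_fun (affineAction_loopElt_sl2E n) v
  · exact LinearMap.congr_fun (affineAction_loopElt_sl2F n) v
  · exact LinearMap.congr_fun (affineAction_loopElt_sl2H n) v
  · exact LinearMap.congr_fun affineAction_centralK v
  -- Invariance is immediate, as the union is the whole space.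
  · rw [iUnion_basicSubspace]
    trivial
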